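/- Let $P$ be a nontrivial partial combinatory algebra, with finite sequences of elements of $P$ coded as elements $\langle a_1,\dots,a_k\rangle$ of $P$ in the standard way. For $A\subseteq P$ let $!A$ be the set of codes of finite sequences with all entries in $A$, and for codes write $m\preceq n$ if every entry of $m$ is an entry of $n$. Let $\Sigma$ be the set of pairs $(A_0,A_1)$ with $A_1\subseteq P$ and $A_0\subseteq\,!A_1$ upwards closed in $!A_1$ with respect to $\preceq$. For every set $I$, preorder $\Sigma^I$ by: $\phi\le\psi$ iff there is $r\in P$ such that for all $i\in I$ and $n\in P$, if $n\in\,!\phi(i)_1$ then $r\cdot n$ is defined and in $!\psi(i)_1$, and if $n\in\phi(i)_0$ then $r\cdot n\in\psi(i)_0$. With reindexing by precomposition this is the Herbrand tripos. The Herbrand topos $\mathbf{HT}[P]$ is the associated category: its objects $(X,=)$ are sets $X$ with a map $[\![\cdot=\cdot]\!]:X\times X\to\Sigma$ that is symmetric and transitive in the logic of the tripos, and its morphisms are the equivalence classes (under mutual entailment) of $\Sigma$-valued functional relations, i.e. relations that are strict, extensional, single-valued and total in the logic of the tripos. Let $\nabla:\mathbf{Sets}\to\mathbf{HT}[P]$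 send a set $Z$ to $Z$ with $[\![z=z]\!]=(!P,P)$ and $[\![z=w]\!]=(\emptyset,P)$ for $z\ne w$, and a function $f:Z\to W$ to the morphism represented by $F(z,w)=[\![f(z)=w]\!]$. Let $\Gamma:\mathbf{HT}[P]\to\mathbf{Sets}$ send $(X,=)$ to $X_0/{\sim}$, where $X_0=\{x\in X: [\![x=x]\!]_0\ne\emptyset\}$ and $x\sim x'$ iff $[\![x=x']\!]_0\neq\emptyset$, and send the morphism represented by $F$ to the function $[x]\mapsto[y]$ whenever $F(x,y)_0\ne\emptyset$. A monomorphism $A\to B$ is called $\neg\neg$-dense if the double pseudocomplement $\neg\neg A$ in the poset of subobjects of $B$ is the largest subobject, and an object $S$ is a $\neg\neg$-sheaf if every morphism $A\to S$ extends uniquely along every $\neg\neg$-dense monomorphism $A\to B$. Proposition. (i) $\mathbf{HT}[P]$ has finite limits, $\Gamma$ preserves finite limits, and $\Gamma\nabla\cong 1$. (ii) $\Gamma$ is left adjoint to $\nabla$, by an adjunction whose unit $\eta_{(X,=)}:(X,=)\to\nabla\Gamma(X,=)$ is represented by $H(x,c)=[\![x=x]\!]$ if $x\in c$, and $H(x,c)=(\emptyset,[\![x=x]\!]_1)$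 otherwise. For this adjunction and every object $(X,=)$ of $\mathbf{HT}[P]$ the following are equivalent: 1. $\eta_{(X,=)}$ is an isomorphism; 2. $(X,=)$ is isomorphic to $\nabla Z$ for some set $Z$; 3. $(X,=)$ is a $\neg\neg$-sheaf. (iii) Every $\nabla Z$ is a $\neg\neg$-sheaf, and $\nabla$ is an equivalence from $\mathbf{Sets}$ to the full subcategory of $\mathbf{HT}[P]$ on the $\neg\neg$-sheaves. Thus $\mathbf{Sets}$ is the subtopos of $\neg\neg$-sheaves. -/

import Mathlib

open CategoryTheory

set_option linter.unusedSectionVars false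

universe u

/-! ## Partial combinatory algebras -/

/-- A partial combinatory algebra (with chosen combinators `k` and `s`): a set with a partial
binary application such that `k·a·b = a`, `s·a·b` is always defined, and
`s·a·b·c ≃ (a·c)·(b·c)` (both sides are defined or undefined together, and equal if defined). -/
class PCA (P : Type u) where
  app : P → P → Part P
  k : P
  s : P
  k_app_app : ∀ a b : P, (app k a).bind (fun x => app x b) = Part.some a
  s_app_app_dom : ∀ a b : P, ((app s a).bind fun x => app x b).Dom
  s_app_app_app : ∀ a b c : P,
    (((app s a).bind fun x => app x b).bind fun x => app x c) =
      (app a c).bind fun x => (app b c).bind fun y => app x y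

namespace PCA

variable {P : Type u} [PCA P]

theorem k_app_dom (a : P) : (app k a).Dom := by
  have h : ((app k a).bind (fun x => app x a)).Dom := by
    rw [k_app_app]; trivial
  exact Part.Dom.of_bind h

theorem s_app_dom (a : P) : (app s a).Dom :=
  Part.Dom.of_bind (s_app_app_dom a a)

/-- The element `k·a`. -/
def ka (a : P) : P := (app k a).get (k_app_dom a)

/-- The element `s·a`. -/
def sa (a : P) : P := (app s a).get (s_app_dom a)

theorem app_k (a : P) : app k a = Part.some (ka a) := (Part.some_get _).symm

theorem app_s (a : P) : app s a = Part.some (sa a) := (Part.some_get _).symm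

theorem sa_app_dom (a b : P) : (app (sa a) b).Dom := by
  have h := s_app_app_dom a b
  rwa [app_s, Part.bind_some] at h

/-- The element `s·a·b`. -/
def sab (a b : P) : P := (app (sa a) b).get (sa_app_dom a b)

theorem app_sa (a b : P) : app (sa a) b = Part.some (sab a b) := (Part.some_get _).symm

theorem app_ka (a b : P) : app (ka a) b = Part.some a := by
  have h := k_app_app a b
  rwa [app_k, Part.bind_some] at h

theorem app_sab (a b c : P) :
    app (sab a b) c = (app a c).bind fun x => (app b c).bind fun y => app x y := by
  have h := s_app_app_app a b c
  rwa [app_s, Part.bind_some, app_sa, Part.bind_some] at h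

/-- The identity combinator `s·k·k`. -/
def i : P := sab k k

theorem app_i (a : P) : app i a = Part.some a := by
  simp [i, app_sab, app_k, app_ka]

/-- The Church numeral `0 = λ f x. x`. -/
def zero : P := ka i

/-- The Church numeral `1 = λ f x. f x`. -/
def one : P := sab (sab (ka s) k) (ka i)

/-- The value of `p·a·b`, where `p = λ a b z. z a b` is the pairing combinator (with projections
`x ↦ x·k` and `x ↦ x·(k·i)`). -/
def pair (a b : P) : P := sab (sab i (ka a)) (ka b)

theorem app_pair (a b z : P) : app (pair a b) z = (app z a).bind fun x => app x b := by
  simp [pair, app_sab, app_ka, app_i]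

theorem app_zero (f : P) : app zero f = Part.some i := app_ka _ _

theorem app_one (f : P) : app one f = Part.some (sab (ka f) i) := by
  simp [one, app_sab, app_ka, app_k, app_s, app_sa]

theorem app_one' (f x : P) : app (sab (ka f) i) x = app f x := by
  simp [app_sab, app_ka, app_i]

theorem pair_inj {a b c d : P} (h : pair a b = pair c d) : a = c ∧ b = d := by
  constructor
  · have h1 : app (pair a b) k = app (pair c d) k := by rw [h]
    simpa [app_pair, app_k, app_ka] using h1
  · have h1 : app (pair a b) zero = app (pair c d) zero := by rw [h]
    simpa [app_pair, app_zero, app_i] using h1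

theorem zero_ne_one [Nontrivial P] : (zero : P) ≠ one := by
  intro h
  obtain ⟨a, b, hab⟩ := exists_pair_ne P
  have h1 : (app zero (ka a)).bind (fun x => app x b) =
      (app one (ka a)).bind (fun x => app x b) := by rw [h]
  simp only [app_zero, app_one, Part.bind_some, app_i, app_one', app_ka] at h1
  exact hab (Part.some_injective h1).symm

/-! ### Coded finite sequences -/

/-- The code `<a₁, …, aₖ>` of a finite sequence:
`<> = p·0·0` and `<a₁, …, aₖ> = p·1·(p·a₁·<a₂, …, aₖ>)`. -/
def code : List P → P
  | [] => pair zero zero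
  | a :: l => pair one (pair a (code l))

theorem code_injective [Nontrivial P] : Function.Injective (code : List P → P) := by
  intro l
  induction l with
  | nil =>
    intro m h
    cases m with
    | nil => rfl
    | cons b m => exact absurd (pair_inj h).1 zero_ne_one
  | cons a l ih =>
    intro m h
    cases m with
    | nil => exact absurd (pair_inj h).1.symm zero_ne_one
    | cons b m =>
      obtain ⟨h1, h2⟩ := pair_inj (pair_inj h).2
      rw [h1, ih h2]

/-- `!A`: the set of codes of finite sequences all of whose entries belong to `A`. -/
def bang (A : Set P) : Set P := {n | ∃ l : List P, (∀ a ∈ l, a ∈ A) ∧ n = code l}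

/-- `m ⪯ n`: every entry of the coded sequence `m` is an entry of the coded sequence `n`. -/
def seqLE (m n : P) : Prop := ∃ l l' : List P, m = code l ∧ n = code l' ∧ l ⊆ l'

/-- The upward closure in `!A` of a set of coded sequences. -/
def upClosure (A S : Set P) : Set P := {n | n ∈ bang A ∧ ∃ m ∈ S, seqLE m n}

/-- `A & B = {p·0·a | a ∈ A} ∪ {p·1·b | b ∈ B}`. -/
def amp (A B : Set P) : Set P := {c | (∃ a ∈ A, c = pair zero a) ∨ ∃ b ∈ B, c = pair one b}

theorem code_mem_bang [Nontrivial P] {A : Set P} {l : List P} :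
    code l ∈ bang A ↔ ∀ a ∈ l, a ∈ A := by
  constructor
  · rintro ⟨l', h, e⟩
    rwa [code_injective e]
  · intro h
    exact ⟨l, h, rfl⟩

theorem seqLE_code [Nontrivial P] {l l' : List P} : seqLE (code l) (code l') ↔ l ⊆ l' := by
  constructor
  · rintro ⟨m, m', e, e', h⟩
    rwa [code_injective e, code_injective e']
  · intro h
    exact ⟨l, l', rfl, rfl, h⟩

theorem seqLE_trans [Nontrivial P] {a b c : P} (h : seqLE a b) (h' : seqLE b c) : seqLE a c := by
  obtain ⟨l, m, rfl, rfl, h⟩ := h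
  obtain ⟨m', n, e, rfl, h'⟩ := h'
  rw [← code_injective e] at h'
  exact ⟨l, n, rfl, rfl, fun x hx => h' (h hx)⟩

/-! ### Combinatory completeness and operations on sequences

Terms over `P` in de Bruijn notation, and abstraction. -/

/-- Terms over `P`. -/
inductive Tm (P : Type u) : Type u
  | var : ℕ → Tm P
  | cst : P → Tm P
  | ap : Tm P → Tm P → Tm P

/-- Extending a valuation. -/
def ext (a : P) (ρ : ℕ → P) : ℕ → P
  | 0 => a
  | n + 1 => ρ n

/-- The value of a term under a valuation. -/
def Tm.ev (ρ : ℕ → P) : Tm P → Part P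
  | .var n => Part.some (ρ n)
  | .cst a => Part.some a
  | .ap t u => (t.ev ρ).bind fun x => (u.ev ρ).bind fun y => app x y

/-- Abstraction of the variable `0`. -/
def Tm.lam : Tm P → Tm P
  | .var 0 => .cst i
  | .var (n + 1) => .ap (.cst k) (.var n)
  | .cst a => .cst (ka a)
  | .ap t u => .ap (.ap (.cst s) t.lam) u.lam

theorem Tm.exists_closure (t : Tm P) (ρ : ℕ → P) :
    ∃ v, t.lam.ev ρ = Part.some v ∧ ∀ a, app v a = t.ev (ext a ρ) := by
  induction t with
  | var n =>
    cases n with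
    | zero => exact ⟨i, rfl, fun a => by simp [app_i, Tm.ev, ext]⟩
    | succ n =>
      exact ⟨ka (ρ n), by simp [Tm.lam, Tm.ev, app_k], fun a => by simp [app_ka, Tm.ev, ext]⟩
  | cst b => exact ⟨ka b, rfl, fun a => by simp [app_ka, Tm.ev]⟩
  | ap t u iht ihu =>
    obtain ⟨v, hv, hv'⟩ := iht
    obtain ⟨w, hw, hw'⟩ := ihu
    exact ⟨sab v w, by simp [Tm.lam, Tm.ev, hv, hw, app_s, app_sa], fun a => by
      simp [app_sab, hv', hw', Tm.ev]⟩

/-- The value of an abstraction. -/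
noncomputable def Tm.clo (ρ : ℕ → P) (t : Tm P) : P := (t.exists_closure ρ).choose

theorem Tm.ev_lam (ρ : ℕ → P) (t : Tm P) : t.lam.ev ρ = Part.some (t.clo ρ) :=
  (t.exists_closure ρ).choose_spec.1

theorem Tm.app_clo (ρ : ℕ → P) (t : Tm P) (a : P) : app (t.clo ρ) a = t.ev (ext a ρ) :=
  (t.exists_closure ρ).choose_spec.2 a

/-- The empty valuation. -/
def ε : ℕ → P := fun _ => i

/-- A term for `p·t·u`. -/
def Tm.pr (t u : Tm P) : Tm P :=
  .ap (.ap (.cst s) (.ap (.ap (.cst s) (.cst i)) (.ap (.cst k) t))) (.ap (.cst k) u)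

theorem Tm.ev_pr {ρ : ℕ → P} {t u : Tm P} {a b : P} (h : t.ev ρ = Part.some a)
    (h' : u.ev ρ = Part.some b) : (Tm.pr t u).ev ρ = Part.some (pair a b) := by
  simp [Tm.pr, Tm.ev, h, h', app_s, app_sa, app_k, pair]

/-- Case distinction on the first component `0` or `1` of a pair, applied to the second one. -/
def Tm.cases (t z o : Tm P) : Tm P :=
  .ap (.ap (.ap (.ap t (.cst k)) (.ap (.cst k) o)) z) (.ap t (.cst zero))

theorem Tm.ev_cases_zero {ρ : ℕ → P} {t z o : Tm P} {b vz vo : P}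
    (h : t.ev ρ = Part.some (pair zero b)) (hz : z.ev ρ = Part.some vz)
    (ho : o.ev ρ = Part.some vo) : (Tm.cases t z o).ev ρ = app vz b := by
  simp [Tm.cases, Tm.ev, h, hz, ho, app_pair, app_k, app_ka, app_zero, app_i]

theorem Tm.ev_cases_one {ρ : ℕ → P} {t z o : Tm P} {b vz vo : P}
    (h : t.ev ρ = Part.some (pair one b)) (hz : z.ev ρ = Part.some vz)
    (ho : o.ev ρ = Part.some vo) : (Tm.cases t z o).ev ρ = app vo b := by
  simp [Tm.cases, Tm.ev, h, hz, ho, app_pair, app_k, app_ka, app_zero, app_i, app_one, app_one']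

/-- The recursion step for concatenation; variables: `l`, `m`, self. -/
def appendBody : Tm P :=
  Tm.cases (.var 0) (Tm.lam (.var 2))
    (Tm.lam (Tm.pr (.cst one) (Tm.pr (.ap (.var 0) (.cst k))
      (.ap (.ap (.ap (.var 3) (.var 3)) (.var 2)) (.ap (.var 0) (.cst zero))))))

/-- The self-applicable element for concatenation. -/
noncomputable def appendEl : P := Tm.clo ε (Tm.lam (Tm.lam appendBody))

/-- A term for the concatenation of two coded sequences. -/
noncomputable def Tm.append (t u : Tm P) : Tm P :=
  .ap (.ap (.ap (.cst appendEl) (.cst appendEl)) u) t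

theorem append_aux (m l : List P) :
    app (Tm.clo (ext (code m) (ext appendEl ε)) appendBody) (code l) =
      Part.some (code (l ++ m)) := by
  induction l with
  | nil =>
    rw [Tm.app_clo, appendBody, Tm.ev_cases_zero (b := zero) rfl (Tm.ev_lam _ _) (Tm.ev_lam _ _),
      Tm.app_clo]
    rfl
  | cons a l ih =>
    rw [Tm.app_clo, appendBody, Tm.ev_cases_one (b := pair a (code l)) rfl (Tm.ev_lam _ _)
      (Tm.ev_lam _ _), Tm.app_clo]
    refine Tm.ev_pr rfl (Tm.ev_pr ?_ ?_)
    · simp [Tm.ev, ext, app_pair, app_k, app_ka]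
    · simp only [Tm.ev, ext, Part.bind_some, app_pair, app_zero, app_i]
      conv_lhs => enter [1, 1, 1]; rw [appendEl]
      rw [Tm.app_clo, Tm.ev_lam, Part.bind_some, Tm.app_clo, Tm.ev_lam, Part.bind_some]
      exact ih

theorem Tm.ev_append {ρ : ℕ → P} {t u : Tm P} {l m : List P} (h : t.ev ρ = Part.some (code l))
    (h' : u.ev ρ = Part.some (code m)) :
    (Tm.append t u).ev ρ = Part.some (code (l ++ m)) := by
  simp only [Tm.append, Tm.ev, h, h', Part.bind_some]
  conv_lhs => enter [1, 1, 1]; rw [appendEl]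
  rw [Tm.app_clo, Tm.ev_lam, Part.bind_some, Tm.app_clo, Tm.ev_lam, Part.bind_some]
  exact append_aux m l

/-- The recursion step for `flat`; variables: `l`, `g`, self. -/
noncomputable def flatBody : Tm P :=
  Tm.cases (.var 0) (Tm.lam (.cst (code [])))
    (Tm.lam (Tm.append (.ap (.var 2) (.ap (.var 0) (.cst k)))
      (.ap (.ap (.ap (.var 3) (.var 3)) (.var 2)) (.ap (.var 0) (.cst zero)))))

/-- The self-applicable element for `flat`. -/
noncomputable def flatEl : P := Tm.clo ε (Tm.lam (Tm.lam flatBody))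

/-- A term for `g·a₁ * … * g·aₖ`, given `g` and `<a₁, …, aₖ>`. -/
noncomputable def Tm.flat (g t : Tm P) : Tm P :=
  .ap (.ap (.ap (.cst flatEl) (.cst flatEl)) g) t

theorem flat_aux [Nontrivial P] (g : P) (l : List P) (h : ∀ a ∈ l, ∃ L, app g a = Part.some (code L)) :
    ∃ L', app (Tm.clo (ext g (ext flatEl ε)) flatBody) (code l) = Part.some (code L') ∧
      ∀ b, b ∈ L' ↔ ∃ a ∈ l, ∃ L, app g a = Part.some (code L) ∧ b ∈ L := by
  induction l with
  | nil =>
    refine ⟨[], ?_, by simp⟩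
    rw [Tm.app_clo, flatBody, Tm.ev_cases_zero (b := zero) rfl (Tm.ev_lam _ _) (Tm.ev_lam _ _),
      Tm.app_clo]
    rfl
  | cons a l ih =>
    obtain ⟨L', hL', hm⟩ := ih fun x hx => h x (List.mem_cons_of_mem _ hx)
    obtain ⟨L, hL⟩ := h a List.mem_cons_self
    refine ⟨L ++ L', ?_, fun b => ?_⟩
    · rw [Tm.app_clo, flatBody, Tm.ev_cases_one (b := pair a (code l)) rfl (Tm.ev_lam _ _)
        (Tm.ev_lam _ _), Tm.app_clo]
      have e : app (flatEl : P) flatEl = Part.some (Tm.clo (ext flatEl ε) (Tm.lam flatBody)) := by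
        conv_lhs => enter [1]; rw [flatEl]
        rw [Tm.app_clo, Tm.ev_lam]
      refine Tm.ev_append ?_ ?_
      · simp [Tm.ev, ext, app_pair, app_k, app_ka, hL]
      · simp only [Tm.ev, ext, Part.bind_some, app_pair, app_zero, app_i, e]
        rw [Tm.app_clo, Tm.ev_lam, Part.bind_some]
        exact hL'
    · rw [List.mem_append, hm]
      constructor
      · rintro (hb | ⟨x, hx, M, hM, hb⟩)
        · exact ⟨a, List.mem_cons_self, L, hL, hb⟩
        · exact ⟨x, List.mem_cons_of_mem _ hx, M, hM, hb⟩
      · rintro ⟨x, hx, M, hM, hb⟩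
        rcases List.mem_cons.1 hx with rfl | hx
        · left
          rw [hL] at hM
          rwa [code_injective (Part.some_injective hM)]
        · exact Or.inr ⟨x, hx, M, hM, hb⟩

theorem Tm.ev_flat [Nontrivial P] {ρ : ℕ → P} {t u : Tm P} {g : P} {l : List P} (hg : t.ev ρ = Part.some g)
    (hl : u.ev ρ = Part.some (code l)) (h : ∀ a ∈ l, ∃ L, app g a = Part.some (code L)) :
    ∃ L', (Tm.flat t u).ev ρ = Part.some (code L') ∧
      ∀ b, b ∈ L' ↔ ∃ a ∈ l, ∃ L, app g a = Part.some (code L) ∧ b ∈ L := by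
  simp only [Tm.flat, Tm.ev, hg, hl, Part.bind_some]
  have e : app (flatEl : P) flatEl = Part.some (Tm.clo (ext flatEl ε) (Tm.lam flatBody)) := by
    conv_lhs => enter [1]; rw [flatEl]
    rw [Tm.app_clo, Tm.ev_lam]
  rw [e, Part.bind_some, Tm.app_clo, Tm.ev_lam, Part.bind_some]
  exact flat_aux g l h

/-! ### Elements of a pca computing operations on sequences -/

theorem exists_singleton : ∃ r : P, ∀ n, app r n = Part.some (code [n]) :=
  ⟨Tm.clo ε (Tm.pr (.cst one) (Tm.pr (.var 0) (.cst (code [])))), fun n => by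
    rw [Tm.app_clo]; exact Tm.ev_pr rfl (Tm.ev_pr rfl rfl)⟩

theorem exists_const (a : P) : ∃ r : P, ∀ n, app r n = Part.some a :=
  ⟨ka a, fun n => app_ka a n⟩

theorem exists_comp (r r' : P) : ∃ q : P, ∀ n, app q n = (app r n).bind fun m => app r' m :=
  ⟨Tm.clo ε (.ap (.cst r') (.ap (.cst r) (.var 0))), fun n => by
    rw [Tm.app_clo]; simp [Tm.ev, ext]⟩

/-- A term for the function tagging the entries of a coded sequence. -/
noncomputable def Tm.tag (c : P) (t : Tm P) : Tm P :=
  Tm.flat (.cst (Tm.clo ε (Tm.pr (.cst one) (Tm.pr (Tm.pr (.cst c) (.var 0)) (.cst (code []))))))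
    t

theorem Tm.ev_tag [Nontrivial P] {ρ : ℕ → P} {t : Tm P} {l : List P} (c : P)
    (h : t.ev ρ = Part.some (code l)) :
    ∃ L, (Tm.tag c t).ev ρ = Part.some (code L) ∧ ∀ b, b ∈ L ↔ ∃ a ∈ l, b = pair c a := by
  have key : ∀ a, app (Tm.clo ε (Tm.pr (.cst one) (Tm.pr (Tm.pr (.cst c) (.var 0))
      (.cst (code []))))) a = Part.some (code [pair c a]) := fun a => by
    rw [Tm.app_clo]; exact Tm.ev_pr rfl (Tm.ev_pr (Tm.ev_pr rfl rfl) rfl)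
  obtain ⟨L, hL, hm⟩ := Tm.ev_flat (ρ := ρ) (t := .cst _) rfl h fun a _ => ⟨_, key a⟩
  refine ⟨L, hL, fun b => ?_⟩
  rw [hm]
  constructor
  · rintro ⟨a, ha, M, hM, hb⟩
    rw [key] at hM
    rw [← code_injective (Part.some_injective hM)] at hb
    exact ⟨a, ha, by simpa using hb⟩
  · rintro ⟨a, ha, rfl⟩
    exact ⟨a, ha, _, key a, by simp⟩

theorem exists_merge [Nontrivial P] (r r' : P) : ∃ q : P, ∀ (n : P) (l m : List P),
    app r n = Part.some (code l) → app r' n = Part.some (code m) →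
    ∃ L, app q n = Part.some (code L) ∧
      ∀ b, b ∈ L ↔ (∃ a ∈ l, b = pair zero a) ∨ ∃ a ∈ m, b = pair one a := by
  refine ⟨Tm.clo ε (Tm.append (Tm.tag zero (.ap (.cst r) (.var 0)))
    (Tm.tag one (.ap (.cst r') (.var 0)))), fun n l m hl hm => ?_⟩
  obtain ⟨L, hL, h⟩ := Tm.ev_tag (ρ := ext n ε) (t := .ap (.cst r) (.var 0)) zero
    (by simpa [Tm.ev, ext] using hl)
  obtain ⟨M, hM, h'⟩ := Tm.ev_tag (ρ := ext n ε) (t := .ap (.cst r') (.var 0)) one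
    (by simpa [Tm.ev, ext] using hm)
  refine ⟨L ++ M, ?_, fun b => by rw [List.mem_append, h, h']⟩
  rw [Tm.app_clo]
  exact Tm.ev_append hL hM

theorem exists_untag_zero [Nontrivial P] : ∃ q : P, ∀ (A B : Set P) (l : List P),
    (∀ a ∈ l, a ∈ amp A B) → ∃ L, app q (code l) = Part.some (code L) ∧
      ∀ b, b ∈ L ↔ pair zero b ∈ l := by
  obtain ⟨g, key0, key1⟩ : ∃ g : P, (∀ a, app g (pair zero a) = Part.some (code [a])) ∧
      ∀ a, app g (pair one a) = Part.some (code []) := by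
    refine ⟨Tm.clo ε (Tm.cases (.var 0)
      (Tm.lam (Tm.pr (.cst one) (Tm.pr (.var 0) (.cst (code [])))))
      (Tm.lam (.cst (code [])))), fun a => ?_, fun a => ?_⟩
    · rw [Tm.app_clo, Tm.ev_cases_zero rfl (Tm.ev_lam _ _) (Tm.ev_lam _ _), Tm.app_clo]
      exact Tm.ev_pr rfl (Tm.ev_pr rfl rfl)
    · rw [Tm.app_clo, Tm.ev_cases_one rfl (Tm.ev_lam _ _) (Tm.ev_lam _ _), Tm.app_clo]
      rfl
  refine ⟨Tm.clo ε (Tm.flat (.cst g) (.var 0)), fun A B l hl => ?_⟩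
  obtain ⟨L, hL, hm⟩ := Tm.ev_flat (ρ := ext (code l) ε) (t := .cst g) (u := .var 0) rfl rfl
    (l := l) fun a ha => by
      rcases hl a ha with ⟨x, _, rfl⟩ | ⟨x, _, rfl⟩
      · exact ⟨_, key0 x⟩
      · exact ⟨_, key1 x⟩
  refine ⟨L, by rw [Tm.app_clo]; exact hL, fun b => ?_⟩
  rw [hm]
  constructor
  · rintro ⟨a, ha, M, hM, hb⟩
    rcases hl a ha with ⟨x, _, rfl⟩ | ⟨x, _, rfl⟩
    · rw [key0] at hM
      rw [← code_injective (Part.some_injective hM), List.mem_singleton] at hb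
      rwa [hb]
    · rw [key1] at hM
      rw [← code_injective (Part.some_injective hM)] at hb
      simp at hb
  · intro hb
    exact ⟨_, hb, _, key0 b, by simp⟩

theorem exists_untag_one [Nontrivial P] : ∃ q : P, ∀ (A B : Set P) (l : List P),
    (∀ a ∈ l, a ∈ amp A B) → ∃ L, app q (code l) = Part.some (code L) ∧
      ∀ b, b ∈ L ↔ pair one b ∈ l := by
  obtain ⟨g, key0, key1⟩ : ∃ g : P, (∀ a, app g (pair zero a) = Part.some (code [])) ∧
      ∀ a, app g (pair one a) = Part.some (code [a]) := by
    refine ⟨Tm.clo ε (Tm.cases (.var 0)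
      (Tm.lam (.cst (code [])))
      (Tm.lam (Tm.pr (.cst one) (Tm.pr (.var 0) (.cst (code [])))))), fun a => ?_, fun a => ?_⟩
    · rw [Tm.app_clo, Tm.ev_cases_zero rfl (Tm.ev_lam _ _) (Tm.ev_lam _ _), Tm.app_clo]
      rfl
    · rw [Tm.app_clo, Tm.ev_cases_one rfl (Tm.ev_lam _ _) (Tm.ev_lam _ _), Tm.app_clo]
      exact Tm.ev_pr rfl (Tm.ev_pr rfl rfl)
  refine ⟨Tm.clo ε (Tm.flat (.cst g) (.var 0)), fun A B l hl => ?_⟩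
  obtain ⟨L, hL, hm⟩ := Tm.ev_flat (ρ := ext (code l) ε) (t := .cst g) (u := .var 0) rfl rfl
    (l := l) fun a ha => by
      rcases hl a ha with ⟨x, _, rfl⟩ | ⟨x, _, rfl⟩
      · exact ⟨_, key0 x⟩
      · exact ⟨_, key1 x⟩
  refine ⟨L, by rw [Tm.app_clo]; exact hL, fun b => ?_⟩
  rw [hm]
  constructor
  · rintro ⟨a, ha, M, hM, hb⟩
    rcases hl a ha with ⟨x, _, rfl⟩ | ⟨x, _, rfl⟩
    · rw [key0] at hM
      rw [← code_injective (Part.some_injective hM)] at hb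
      simp at hb
    · rw [key1] at hM
      rw [← code_injective (Part.some_injective hM), List.mem_singleton] at hb
      rwa [hb]
  · intro hb
    exact ⟨_, hb, _, key1 b, by simp⟩

/-- An element computing, from `n` and a code `<a₁, …, aₖ>` obtained as `e·n`, the concatenation
of the values of `r` at codes of the sequences made up of the entries of `n`, tagged by `0`, and
those of `aⱼ`, tagged by `1`. -/
theorem exists_flat_merge [Nontrivial P] (e r : P) : ∃ q : P, ∀ (l m : List P),
    app e (code l) = Part.some (code m) →
    (∀ a ∈ m, ∃ L, a = code L) →
    (∀ L, code L ∈ m → ∀ M : List P,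
      (∀ b, b ∈ M ↔ (∃ a ∈ l, b = pair zero a) ∨ ∃ a ∈ L, b = pair one a) →
        ∃ N, app r (code M) = Part.some (code N)) →
    ∃ R, app q (code l) = Part.some (code R) ∧
      (∀ b ∈ R, ∃ L M N, code L ∈ m ∧
        (∀ b, b ∈ M ↔ (∃ a ∈ l, b = pair zero a) ∨ ∃ a ∈ L, b = pair one a) ∧
          app r (code M) = Part.some (code N) ∧ b ∈ N) ∧
      (∀ L, code L ∈ m → ∃ M N,
        (∀ b, b ∈ M ↔ (∃ a ∈ l, b = pair zero a) ∨ ∃ a ∈ L, b = pair one a) ∧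
          app r (code M) = Part.some (code N) ∧ N ⊆ R) := by
  let g : Tm P := .ap (.cst r) (Tm.append (Tm.tag zero (.var 1)) (Tm.tag one (.var 0)))
  refine ⟨Tm.clo ε (Tm.flat (Tm.lam g) (.ap (.cst e) (.var 0))), fun l m hm hc hr => ?_⟩
  have key : ∀ L, code L ∈ m → ∃ M N,
      (∀ b, b ∈ M ↔ (∃ a ∈ l, b = pair zero a) ∨ ∃ a ∈ L, b = pair one a) ∧
        app r (code M) = Part.some (code N) ∧
        app (Tm.clo (ext (code l) ε) g) (code L) = Part.some (code N) := fun L hL => by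
    obtain ⟨M1, h1, h1'⟩ := Tm.ev_tag (ρ := ext (code L) (ext (code l) ε)) (t := .var 1) (l := l)
      zero rfl
    obtain ⟨M2, h2, h2'⟩ := Tm.ev_tag (ρ := ext (code L) (ext (code l) ε)) (t := .var 0) (l := L)
      one rfl
    have hM : ∀ b, b ∈ M1 ++ M2 ↔ (∃ a ∈ l, b = pair zero a) ∨ ∃ a ∈ L, b = pair one a :=
      fun b => by rw [List.mem_append, h1', h2']
    obtain ⟨N, hN⟩ := hr L hL _ hM
    refine ⟨_, N, hM, hN, ?_⟩
    rw [Tm.app_clo]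
    simp only [g, Tm.ev, Part.bind_some, Tm.ev_append h1 h2, hN]
  obtain ⟨R, hR, hRm⟩ := Tm.ev_flat (ρ := ext (code l) ε) (t := Tm.lam g)
    (u := .ap (.cst e) (.var 0)) (l := m) (Tm.ev_lam _ _) (by simpa [Tm.ev, ext] using hm)
    fun a ha => by
      obtain ⟨L, rfl⟩ := hc a ha
      obtain ⟨M, N, _, _, h⟩ := key L ha
      exact ⟨N, h⟩
  refine ⟨R, by rw [Tm.app_clo]; exact hR, fun b hb => ?_, fun L hL => ?_⟩
  · obtain ⟨a, ha, N', hN', hb⟩ := (hRm b).1 hb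
    obtain ⟨L, rfl⟩ := hc a ha
    obtain ⟨M, N, hM, hN, h⟩ := key L ha
    rw [h] at hN'
    rw [← code_injective (Part.some_injective hN')] at hb
    exact ⟨L, M, N, ha, hM, hN, hb⟩
  · obtain ⟨M, N, hM, hN, h⟩ := key L hL
    exact ⟨M, N, hM, hN, fun b hb => (hRm b).2 ⟨_, hL, N, h, hb⟩⟩

end PCA

/-! ## The Herbrand tripos -/

open PCA

/-- The set `Σ` of truth values: pairs `(A₀, A₁)` with `A₁ ⊆ P` and `A₀` an upwards closed subset
of `!A₁`. -/
@[ext]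
structure HTruth (P : Type u) [PCA P] where
  act : Set P
  pot : Set P
  act_sub : act ⊆ bang pot
  act_up : ∀ m ∈ act, ∀ n ∈ bang pot, seqLE m n → n ∈ act

namespace HTruth

variable {P : Type u} [PCA P]

/-- `r` tracks the entailment `A ≤ B`. -/
def Tracks (r : P) (A B : HTruth P) : Prop :=
  (∀ n ∈ bang A.pot, ∃ m ∈ app r n, m ∈ bang B.pot) ∧
    ∀ n ∈ A.act, ∃ m ∈ app r n, m ∈ B.act

/-- The preorder on `Σ^I`: some single `r ∈ P` tracks `φ i ≤ ψ i` for all `i`. -/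
def Entails {I : Type u} (φ ψ : I → HTruth P) : Prop :=
  ∃ r : P, ∀ i, Tracks r (φ i) (ψ i)

/-- The top element `(!P, P)`. -/
def top : HTruth P where
  act := bang Set.univ
  pot := Set.univ
  act_sub := fun _ h => h
  act_up := fun _ _ _ h _ => h

/-- The truth value `A` if `p` holds, and `(∅, A₁)` otherwise. -/
def restrict (p : Prop) (A : HTruth P) : HTruth P where
  act := {n | n ∈ A.act ∧ p}
  pot := A.pot
  act_sub := fun _ h => A.act_sub h.1
  act_up := fun m h n hn hmn => ⟨A.act_up m h.1 n hn hmn, h.2⟩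

variable [Nontrivial P]

/-- Conjunction: the potential part is `A₁ & B₁`, and the actual part consists of those elements of
`!(A₁ & B₁)` which correspond to pairs of an element of `A₀` and an element of `B₀` under the
exponential isomorphism `!(A₁ & B₁) ≅ !A₁ ⊗ !B₁`, whose inverse sends (the pair of)
`<a₁, …, aₖ>` and `<b₁, …, bₗ>` to `<p·0·a₁, …, p·0·aₖ, p·1·b₁, …, p·1·bₗ>`. -/
def conj (A B : HTruth P) : HTruth P where
  act := upClosure (amp A.pot B.pot)
    {n | ∃ l m : List P, code l ∈ A.act ∧ code m ∈ B.act ∧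
      n = code (l.map (pair zero) ++ m.map (pair one))}
  pot := amp A.pot B.pot
  act_sub := fun _ h => h.1
  act_up := fun _ h _ hn hmn =>
    ⟨hn, h.2.imp fun _ hs => ⟨hs.1, seqLE_trans hs.2 hmn⟩⟩

/-- Existential quantification of a family of truth values: the fibre of `∃_f` over a point `y`,
for the family of all `φ x` with `x ∈ f⁻¹(y)`. -/
def ex {Y : Type u} (φ : Y → HTruth P) : HTruth P where
  act := upClosure {a | ∃ y, a ∈ bang (φ y).pot} {m | ∃ y, ∃ n ∈ (φ y).act, m = code [n]}
  pot := {a | ∃ y, a ∈ bang (φ y).pot}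
  act_sub := fun _ h => h.1
  act_up := fun _ h _ hn hmn =>
    ⟨hn, h.2.imp fun _ hs => ⟨hs.1, seqLE_trans hs.2 hmn⟩⟩

theorem mem_act_up {A : HTruth P} {l l' : List P} (h : code l ∈ A.act)
    (h' : ∀ a ∈ l', a ∈ A.pot) (hl : l ⊆ l') : code l' ∈ A.act :=
  A.act_up _ h _ (code_mem_bang.2 h') (seqLE_code.2 hl)

theorem tracks_iff {r : P} {A B : HTruth P} : Tracks r A B ↔
    (∀ l : List P, (∀ a ∈ l, a ∈ A.pot) → ∃ m : List P, app r (code l) = Part.some (code m) ∧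
      (∀ a ∈ m, a ∈ B.pot) ∧ (code l ∈ A.act → code m ∈ B.act)) := by
  constructor
  · intro h l hl
    obtain ⟨n, hn, m, hm, rfl⟩ := h.1 (code l) (code_mem_bang.2 hl)
    rw [← Part.eq_some_iff] at hn
    refine ⟨m, hn, hm, fun hA => ?_⟩
    obtain ⟨n', hn', hB⟩ := h.2 _ hA
    rw [hn, Part.mem_some_iff] at hn'
    rwa [← hn']
  · intro h
    constructor
    · rintro _ ⟨l, hl, rfl⟩
      obtain ⟨m, hm, hB, -⟩ := h l hl
      exact ⟨_, Part.eq_some_iff.1 hm, code_mem_bang.2 hB⟩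
    · intro n hn
      obtain ⟨l, hl, rfl⟩ := A.act_sub hn
      obtain ⟨m, hm, -, hB⟩ := h l hl
      exact ⟨_, Part.eq_some_iff.1 hm, hB hn⟩

/-! ### The rules of regular logic -/

theorem act_nonempty_conj {A B : HTruth P} :
    (conj A B).act.Nonempty ↔ A.act.Nonempty ∧ B.act.Nonempty := by
  constructor
  · rintro ⟨n, -, s, ⟨l, m, hl, hm, -⟩, -⟩
    exact ⟨⟨_, hl⟩, ⟨_, hm⟩⟩
  · rintro ⟨⟨a, ha⟩, ⟨b, hb⟩⟩
    obtain ⟨l, hl, rfl⟩ := A.act_sub ha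
    obtain ⟨m, hm, rfl⟩ := B.act_sub hb
    refine ⟨code (l.map (pair zero) ++ m.map (pair one)), code_mem_bang.2 fun c hc => ?_, _,
      ⟨l, m, ha, hb, rfl⟩, seqLE_code.2 fun _ h => h⟩
    rcases List.mem_append.1 hc with hc | hc
    · obtain ⟨x, hx, rfl⟩ := List.mem_map.1 hc
      exact Or.inl ⟨x, hl x hx, rfl⟩
    · obtain ⟨x, hx, rfl⟩ := List.mem_map.1 hc
      exact Or.inr ⟨x, hm x hx, rfl⟩

theorem act_nonempty_ex {Y : Type u} {φ : Y → HTruth P} :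
    (ex φ).act.Nonempty ↔ ∃ y, (φ y).act.Nonempty := by
  constructor
  · rintro ⟨n, -, s, ⟨y, m, hm, -⟩, -⟩
    exact ⟨y, m, hm⟩
  · rintro ⟨y, n, hn⟩
    refine ⟨code [n], code_mem_bang.2 fun c hc => ?_, _, ⟨y, n, hn, rfl⟩,
      seqLE_code.2 fun _ h => h⟩
    rw [List.mem_singleton] at hc
    exact ⟨y, hc ▸ (φ y).act_sub hn⟩

namespace Entails

variable {I : Type u} {χ φ ψ θ : I → HTruth P}

theorem nonempty (h : Entails φ ψ) {x : I} (hx : (φ x).act.Nonempty) : (ψ x).act.Nonempty := by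
  obtain ⟨r, hr⟩ := h
  obtain ⟨n, hn⟩ := hx
  obtain ⟨m, -, hm⟩ := (hr x).2 n hn
  exact ⟨m, hm⟩

theorem refl (φ : I → HTruth P) : Entails φ φ :=
  ⟨PCA.i, fun _ => ⟨fun n hn => ⟨n, by simp [app_i], hn⟩, fun n hn => ⟨n, by simp [app_i], hn⟩⟩⟩

theorem trans (h : Entails φ ψ) (h' : Entails ψ θ) : Entails φ θ := by
  obtain ⟨r, hr⟩ := h
  obtain ⟨r', hr'⟩ := h'
  obtain ⟨q, hq⟩ := exists_comp r r'
  refine ⟨q, fun x => tracks_iff.2 fun l hl => ?_⟩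
  obtain ⟨m, hm, h1, h2⟩ := tracks_iff.1 (hr x) l hl
  obtain ⟨k, hk, h3, h4⟩ := tracks_iff.1 (hr' x) m h1
  exact ⟨k, by rw [hq, hm, Part.bind_some, hk], h3, fun h => h4 (h2 h)⟩

theorem reindex {J : Type u} (h : Entails φ ψ) (f : J → I) :
    Entails (fun j => φ (f j)) (fun j => ψ (f j)) := by
  obtain ⟨r, hr⟩ := h
  exact ⟨r, fun j => hr (f j)⟩

theorem conj_left (φ ψ : I → HTruth P) : Entails (fun i => conj (φ i) (ψ i)) φ := by
  obtain ⟨q, hq⟩ := exists_untag_zero (P := P)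
  refine ⟨q, fun x => tracks_iff.2 fun l hl => ?_⟩
  obtain ⟨L, hL, hm⟩ := hq _ _ l hl
  have hp : ∀ a ∈ L, a ∈ (φ x).pot := fun a ha => by
    rcases hl _ ((hm a).1 ha) with ⟨b, hb, e⟩ | ⟨b, hb, e⟩
    · rwa [(pair_inj e).2]
    · exact absurd (pair_inj e).1 zero_ne_one
  refine ⟨L, hL, hp, ?_⟩
  rintro ⟨-, _, ⟨l', m', hl', hm', rfl⟩, hle⟩
  rw [seqLE_code] at hle
  exact mem_act_up hl' hp fun a ha => (hm a).2 <| hle <|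
    List.mem_append.2 <| Or.inl <| List.mem_map_of_mem ha

theorem conj_right (φ ψ : I → HTruth P) : Entails (fun i => conj (φ i) (ψ i)) ψ := by
  obtain ⟨q, hq⟩ := exists_untag_one (P := P)
  refine ⟨q, fun x => tracks_iff.2 fun l hl => ?_⟩
  obtain ⟨L, hL, hm⟩ := hq _ _ l hl
  have hp : ∀ a ∈ L, a ∈ (ψ x).pot := fun a ha => by
    rcases hl _ ((hm a).1 ha) with ⟨b, hb, e⟩ | ⟨b, hb, e⟩
    · exact absurd (pair_inj e).1.symm zero_ne_one
    · rwa [(pair_inj e).2]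
  refine ⟨L, hL, hp, ?_⟩
  rintro ⟨-, _, ⟨l', m', hl', hm', rfl⟩, hle⟩
  rw [seqLE_code] at hle
  exact mem_act_up hm' hp fun a ha => (hm a).2 <| hle <|
    List.mem_append.2 <| Or.inr <| List.mem_map_of_mem ha

theorem left (h : Entails χ fun i => conj (φ i) (ψ i)) : Entails χ φ := h.trans (conj_left φ ψ)

theorem right (h : Entails χ fun i => conj (φ i) (ψ i)) : Entails χ ψ := h.trans (conj_right φ ψ)

theorem mem_conj_pot {A B : HTruth P} {l m L : List P} (hl : ∀ a ∈ l, a ∈ A.pot)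
    (hm : ∀ a ∈ m, a ∈ B.pot)
    (hL : ∀ b, b ∈ L ↔ (∃ a ∈ l, b = pair zero a) ∨ ∃ a ∈ m, b = pair one a) :
    ∀ b ∈ L, b ∈ (HTruth.conj A B).pot := fun b hb => by
  rcases (hL b).1 hb with ⟨a, ha, rfl⟩ | ⟨a, ha, rfl⟩
  · exact Or.inl ⟨a, hl a ha, rfl⟩
  · exact Or.inr ⟨a, hm a ha, rfl⟩

theorem mem_conj_act {A B : HTruth P} {l m L : List P} (hl : ∀ a ∈ l, a ∈ A.pot)
    (hm : ∀ a ∈ m, a ∈ B.pot)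
    (hL : ∀ b, b ∈ L ↔ (∃ a ∈ l, b = pair zero a) ∨ ∃ a ∈ m, b = pair one a)
    (hA : code l ∈ A.act) (hB : code m ∈ B.act) : code L ∈ (HTruth.conj A B).act := by
  refine ⟨code_mem_bang.2 (mem_conj_pot hl hm hL), _, ⟨l, m, hA, hB, rfl⟩,
    seqLE_code.2 fun b hb => ?_⟩
  rw [hL]
  rcases List.mem_append.1 hb with hb | hb
  · obtain ⟨a, ha, rfl⟩ := List.mem_map.1 hb
    exact Or.inl ⟨a, ha, rfl⟩
  · obtain ⟨a, ha, rfl⟩ := List.mem_map.1 hb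
    exact Or.inr ⟨a, ha, rfl⟩

theorem conj (h : Entails χ φ) (h' : Entails χ ψ) :
    Entails χ fun i => HTruth.conj (φ i) (ψ i) := by
  obtain ⟨r, hr⟩ := h
  obtain ⟨r', hr'⟩ := h'
  obtain ⟨q, hq⟩ := exists_merge r r'
  refine ⟨q, fun x => tracks_iff.2 fun l hl => ?_⟩
  obtain ⟨m, hm, h1, h2⟩ := tracks_iff.1 (hr x) l hl
  obtain ⟨k, hk, h3, h4⟩ := tracks_iff.1 (hr' x) l hl
  obtain ⟨L, hL, hmem⟩ := hq _ _ _ hm hk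
  exact ⟨L, hL, mem_conj_pot h1 h3 hmem, fun h => mem_conj_act h1 h3 hmem (h2 h) (h4 h)⟩

theorem ex_intro {Y : Type u} {φ : I → Y → HTruth P} (f : I → Y)
    (h : Entails χ fun i => φ i (f i)) : Entails χ fun i => ex (φ i) := by
  refine h.trans ?_
  obtain ⟨q, hq⟩ := exists_singleton (P := P)
  refine ⟨q, fun x => tracks_iff.2 fun l hl => ⟨[code l], hq _, fun a ha => ?_, fun h => ?_⟩⟩
  · rw [List.mem_singleton] at ha
    exact ⟨f x, ha ▸ code_mem_bang.2 hl⟩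
  · refine ⟨code_mem_bang.2 fun a ha => ?_, _, ⟨f x, _, h, rfl⟩, seqLE_code.2 fun _ h => h⟩
    rw [List.mem_singleton] at ha
    exact ⟨f x, ha ▸ code_mem_bang.2 hl⟩

theorem ex_elim {Y : Type u} {φ : I → Y → HTruth P} (h : Entails χ fun i => ex (φ i))
    (h' : Entails (fun p : I × Y => HTruth.conj (χ p.1) (φ p.1 p.2)) fun p => ψ p.1) :
    Entails χ ψ := by
  obtain ⟨e, he⟩ := h
  obtain ⟨r, hr⟩ := h'
  obtain ⟨q, hq⟩ := exists_flat_merge e r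
  refine ⟨q, fun x => tracks_iff.2 fun l hl => ?_⟩
  obtain ⟨m, hm, h1, h2⟩ := tracks_iff.1 (he x) l hl
  have hmem : ∀ L, code L ∈ m → ∃ y, ∀ a ∈ L, a ∈ (φ x y).pot := fun L hL => by
    obtain ⟨y, hy⟩ := h1 _ hL
    exact ⟨y, code_mem_bang.1 hy⟩
  obtain ⟨R, hR, h3, h4⟩ := hq l m hm (fun a ha => by
      obtain ⟨y, L, -, e⟩ := h1 a ha
      exact ⟨L, e⟩) (fun L hL M hM => by
      obtain ⟨y, hy⟩ := hmem L hL
      obtain ⟨N, hN, -⟩ := tracks_iff.1 (hr (x, y)) M (mem_conj_pot hl hy hM)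
      exact ⟨N, hN⟩)
  have hp : ∀ b ∈ R, b ∈ (ψ x).pot := fun b hb => by
    obtain ⟨L, M, N, hL, hM, hN, hb⟩ := h3 b hb
    obtain ⟨y, hy⟩ := hmem L hL
    obtain ⟨N', hN', h5, -⟩ := tracks_iff.1 (hr (x, y)) M (mem_conj_pot hl hy hM)
    rw [hN] at hN'
    rw [code_injective (Part.some_injective hN')] at hb
    exact h5 b hb
  refine ⟨R, hR, hp, fun hact => ?_⟩
  obtain ⟨-, _, ⟨y, n, hn, rfl⟩, hle⟩ := h2 hact
  obtain ⟨L, hLp, rfl⟩ := (φ x y).act_sub hn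
  have hL : code L ∈ m := seqLE_code.1 hle (by simp)
  obtain ⟨M, N, hM, hN, hNR⟩ := h4 L hL
  obtain ⟨N', hN', -, h6⟩ := tracks_iff.1 (hr (x, y)) M (mem_conj_pot hl hLp hM)
  rw [hN] at hN'
  rw [← code_injective (Part.some_injective hN')] at h6
  exact mem_act_up (h6 (mem_conj_act hl hLp hM hact hn)) hp hNR

/-- Weakening, in the context of a variable and a hypothesis introduced by `ex_elim`. -/
theorem wk {Y : Type u} {φ' : I × Y → HTruth P} (h : Entails χ φ) :
    Entails (fun p : I × Y => HTruth.conj (χ p.1) (φ' p)) fun p => φ p.1 :=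
  (conj_left _ _).trans (h.reindex Prod.fst)

theorem hyp {Y : Type u} (χ : I → HTruth P) (φ' : I → Y → HTruth P) :
    Entails (fun p : I × Y => HTruth.conj (χ p.1) (φ' p.1 p.2)) fun p => φ' p.1 p.2 :=
  conj_right _ _

theorem restrict_top {p : I → Prop} (h : ∀ i, (χ i).act.Nonempty → p i) :
    Entails χ fun i => restrict (p i) top := by
  refine ⟨PCA.i, fun x => tracks_iff.2 fun l hl => ⟨l, app_i _, fun _ _ => trivial, fun hA => ?_⟩⟩
  exact ⟨⟨l, fun _ _ => trivial, rfl⟩, h x ⟨_, hA⟩⟩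

end Entails

end HTruth

/-! ## The Herbrand topos -/

open HTruth

/-- An object `(X, =)` of the Herbrand topos: a set `X` with a `Σ`-valued relation which is
symmetric and transitive in the logic of the Herbrand tripos. -/
structure HerbrandTopos (P : Type u) [PCA P] [Nontrivial P] where
  carrier : Type u
  eq : carrier → carrier → HTruth P
  eq_symm : Entails (fun p : carrier × carrier => eq p.1 p.2) fun p => eq p.2 p.1
  eq_trans : Entails (fun p : carrier × carrier × carrier => conj (eq p.1 p.2.1) (eq p.2.1 p.2.2))
    fun p => eq p.1 p.2.2

/-- A functional relation `F` from `(X, =)` to `(Y, =)`: a `Σ`-valued relation which is strict,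
relational (extensional), single-valued and total in the logic of the Herbrand tripos. -/
structure FunRel {P : Type u} [PCA P] [Nontrivial P] (X Y : HerbrandTopos P) where
  rel : X.carrier → Y.carrier → HTruth P
  strict : Entails (fun p : X.carrier × Y.carrier => rel p.1 p.2)
    fun p => conj (X.eq p.1 p.1) (Y.eq p.2 p.2)
  congr : Entails
    (fun p : (X.carrier × X.carrier) × Y.carrier × Y.carrier =>
      conj (rel p.1.1 p.2.1) (conj (X.eq p.1.1 p.1.2) (Y.eq p.2.1 p.2.2)))
    fun p => rel p.1.2 p.2.2
  single : Entails
    (fun p : X.carrier × Y.carrier × Y.carrier => conj (rel p.1 p.2.1) (rel p.1 p.2.2))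
    fun p => Y.eq p.2.1 p.2.2
  total : Entails (fun x => X.eq x x) fun x => ex fun y => rel x y

section

variable {P : Type u} [PCA P] [Nontrivial P] {X Y Z W : HerbrandTopos P} {I : Type u}
  {χ : I → HTruth P}

namespace HerbrandTopos

theorem symm' {a b : I → X.carrier} (h : Entails χ fun i => X.eq (a i) (b i)) :
    Entails χ fun i => X.eq (b i) (a i) :=
  h.trans (X.eq_symm.reindex fun i => (a i, b i))

theorem trans' {a b c : I → X.carrier} (h : Entails χ fun i => X.eq (a i) (b i))
    (h' : Entails χ fun i => X.eq (b i) (c i)) : Entails χ fun i => X.eq (a i) (c i) :=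
  (h.conj h').trans (X.eq_trans.reindex fun i => (a i, b i, c i))

theorem left' {a b : I → X.carrier} (h : Entails χ fun i => X.eq (a i) (b i)) :
    Entails χ fun i => X.eq (a i) (a i) := trans' h (symm' h)

theorem right' {a b : I → X.carrier} (h : Entails χ fun i => X.eq (a i) (b i)) :
    Entails χ fun i => X.eq (b i) (b i) := trans' (symm' h) h

end HerbrandTopos

namespace FunRel

open HerbrandTopos

theorem strict_left (F : FunRel X Y) {a : I → X.carrier} {b : I → Y.carrier}
    (h : Entails χ fun i => F.rel (a i) (b i)) : Entails χ fun i => X.eq (a i) (a i) :=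
  (h.trans (F.strict.reindex fun i => (a i, b i))).left

theorem strict_right (F : FunRel X Y) {a : I → X.carrier} {b : I → Y.carrier}
    (h : Entails χ fun i => F.rel (a i) (b i)) : Entails χ fun i => Y.eq (b i) (b i) :=
  (h.trans (F.strict.reindex fun i => (a i, b i))).right

theorem congr' (F : FunRel X Y) {a a' : I → X.carrier} {b b' : I → Y.carrier}
    (h : Entails χ fun i => F.rel (a i) (b i)) (ha : Entails χ fun i => X.eq (a i) (a' i))
    (hb : Entails χ fun i => Y.eq (b i) (b' i)) : Entails χ fun i => F.rel (a' i) (b' i) :=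
  (h.conj (ha.conj hb)).trans (F.congr.reindex fun i => ((a i, a' i), (b i, b' i)))

theorem single' (F : FunRel X Y) {a : I → X.carrier} {b b' : I → Y.carrier}
    (h : Entails χ fun i => F.rel (a i) (b i)) (h' : Entails χ fun i => F.rel (a i) (b' i)) :
    Entails χ fun i => Y.eq (b i) (b' i) :=
  (h.conj h').trans (F.single.reindex fun i => (a i, b i, b' i))

theorem total' (F : FunRel X Y) {a : I → X.carrier} (h : Entails χ fun i => X.eq (a i) (a i)) :
    Entails χ fun i => ex fun y => F.rel (a i) y :=
  h.trans (F.total.reindex a)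

/-- Inclusion of functional relations in the logic of the tripos. -/
def le (F G : FunRel X Y) : Prop :=
  Entails (fun p : X.carrier × Y.carrier => F.rel p.1 p.2) fun p => G.rel p.1 p.2

theorem le_symm {F G : FunRel X Y} (h : F.le G) : G.le F := by
  have h0 := Entails.refl fun p : X.carrier × Y.carrier => G.rel p.1 p.2
  refine (F.total' (G.strict_left h0)).ex_elim ?_
  have hF := Entails.hyp (fun p : X.carrier × Y.carrier => G.rel p.1 p.2)
    fun p y => F.rel p.1 y
  have hG := hF.trans (h.reindex fun p : (X.carrier × Y.carrier) × Y.carrier => (p.1.1, p.2))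
  exact F.congr' hF (F.strict_left hF) (G.single' hG h0.wk)

/-- Two functional relations represent the same morphism if each is contained in the other. -/
instance setoid (X Y : HerbrandTopos P) : Setoid (FunRel X Y) where
  r F G := F.le G ∧ G.le F
  iseqv :=
    ⟨fun _ => ⟨Entails.refl _, Entails.refl _⟩, fun h => ⟨h.2, h.1⟩,
      fun h h' => ⟨h.1.trans h'.1, h'.2.trans h.2⟩⟩

/-- The identity, represented by `[x = x']`. -/
def id (X : HerbrandTopos P) : FunRel X X where
  rel := X.eq
  strict :=
    have h := Entails.refl fun p : X.carrier × X.carrier => X.eq p.1 p.2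
    (left' h).conj (right' h)
  congr := by
    have h := Entails.refl fun p : (X.carrier × X.carrier) × X.carrier × X.carrier =>
      conj (X.eq p.1.1 p.2.1) (conj (X.eq p.1.1 p.1.2) (X.eq p.2.1 p.2.2))
    exact trans' (symm' h.right.left) (trans' h.left h.right.right)
  single := by
    have h := Entails.refl fun p : X.carrier × X.carrier × X.carrier =>
      conj (X.eq p.1 p.2.1) (X.eq p.1 p.2.2)
    exact trans' (symm' h.left) h.right
  total := Entails.ex_intro (fun x => x) (Entails.refl _)

/-- The relation `∃ y, F(x, y) ∧ G(y, z)`. -/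
def compRel (F : FunRel X Y) (G : FunRel Y Z) (x : X.carrier) (z : Z.carrier) : HTruth P :=
  ex fun y => conj (F.rel x y) (G.rel y z)

theorem compRel_intro {F : FunRel X Y} {G : FunRel Y Z} {a : I → X.carrier} {b : I → Y.carrier}
    {c : I → Z.carrier} (h : Entails χ fun i => F.rel (a i) (b i))
    (h' : Entails χ fun i => G.rel (b i) (c i)) : Entails χ fun i => compRel F G (a i) (c i) :=
  Entails.ex_intro b (h.conj h')

/-- Composition of functional relations. -/
def comp (F : FunRel X Y) (G : FunRel Y Z) : FunRel X Z where
  rel := compRel F G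
  strict := by
    refine (Entails.refl _).ex_elim ?_
    have h := Entails.hyp (fun p : X.carrier × Z.carrier => compRel F G p.1 p.2)
      fun p y => conj (F.rel p.1 y) (G.rel y p.2)
    exact (F.strict_left h.left).conj (G.strict_right h.right)
  congr := by
    have h0 := Entails.refl fun p : (X.carrier × X.carrier) × Z.carrier × Z.carrier =>
      conj (compRel F G p.1.1 p.2.1) (conj (X.eq p.1.1 p.1.2) (Z.eq p.2.1 p.2.2))
    refine h0.left.ex_elim ?_
    have h := Entails.hyp (fun p : (X.carrier × X.carrier) × Z.carrier × Z.carrier =>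
      conj (compRel F G p.1.1 p.2.1) (conj (X.eq p.1.1 p.1.2) (Z.eq p.2.1 p.2.2)))
      fun p y => conj (F.rel p.1.1 y) (G.rel y p.2.1)
    have hY := F.strict_right h.left
    exact compRel_intro (F.congr' h.left h0.right.left.wk hY) (G.congr' h.right hY h0.right.right.wk)
  single := by
    have h0 := Entails.refl fun p : X.carrier × Z.carrier × Z.carrier =>
      conj (compRel F G p.1 p.2.1) (compRel F G p.1 p.2.2)
    refine h0.left.ex_elim ?_
    have h1 := Entails.hyp (fun p : X.carrier × Z.carrier × Z.carrier =>
      conj (compRel F G p.1 p.2.1) (compRel F G p.1 p.2.2))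
      fun p y => conj (F.rel p.1 y) (G.rel y p.2.1)
    refine h0.right.wk.ex_elim ?_
    have h2 := Entails.hyp (fun p : (X.carrier × Z.carrier × Z.carrier) × Y.carrier =>
      conj (conj (compRel F G p.1.1 p.1.2.1) (compRel F G p.1.1 p.1.2.2))
        (conj (F.rel p.1.1 p.2) (G.rel p.2 p.1.2.1)))
      fun p y => conj (F.rel p.1.1 y) (G.rel y p.1.2.2)
    have hy := F.single' h2.left h1.left.wk
    exact G.single' h1.right.wk (G.congr' h2.right hy (G.strict_right h2.right))
  total := by
    refine (F.total' (Entails.refl _)).ex_elim ?_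
    have h1 := Entails.hyp (fun x : X.carrier => X.eq x x) fun x y => F.rel x y
    refine (G.total' (F.strict_right h1)).ex_elim ?_
    have h2 := Entails.hyp (fun p : X.carrier × Y.carrier => conj (X.eq p.1 p.1) (F.rel p.1 p.2))
      fun p z => G.rel p.2 z
    exact Entails.ex_intro (fun p => p.2) (compRel_intro h1.wk h2)

theorem comp_le {F F' : FunRel X Y} {G G' : FunRel Y Z} (h : F.le F') (h' : G.le G') :
    (F.comp G).le (F'.comp G') := by
  refine (Entails.refl _).ex_elim ?_
  have h1 := Entails.hyp (fun p : X.carrier × Z.carrier => compRel F G p.1 p.2)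
    fun p y => conj (F.rel p.1 y) (G.rel y p.2)
  exact compRel_intro
    (h1.left.trans (h.reindex fun p : (X.carrier × Z.carrier) × Y.carrier => (p.1.1, p.2)))
    (h1.right.trans (h'.reindex fun p : (X.carrier × Z.carrier) × Y.carrier => (p.2, p.1.2)))

theorem id_comp_le (F : FunRel X Y) : ((FunRel.id X).comp F).le F := by
  refine (Entails.refl _).ex_elim ?_
  have h := Entails.hyp (fun p : X.carrier × Y.carrier => compRel (FunRel.id X) F p.1 p.2)
    fun p x => conj (X.eq p.1 x) (F.rel x p.2)
  exact F.congr' h.right (symm' h.left) (F.strict_right h.right)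

theorem comp_id_le (F : FunRel X Y) : (F.comp (FunRel.id Y)).le F := by
  refine (Entails.refl _).ex_elim ?_
  have h := Entails.hyp (fun p : X.carrier × Y.carrier => compRel F (FunRel.id Y) p.1 p.2)
    fun p y => conj (F.rel p.1 y) (Y.eq y p.2)
  exact F.congr' h.left (F.strict_left h.left) h.right

theorem assoc_le (F : FunRel X Y) (G : FunRel Y Z) (H : FunRel Z W) :
    ((F.comp G).comp H).le (F.comp (G.comp H)) := by
  refine (Entails.refl _).ex_elim ?_
  have h := Entails.hyp (fun p : X.carrier × W.carrier => compRel (F.comp G) H p.1 p.2)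
    fun p z => conj (compRel F G p.1 z) (H.rel z p.2)
  refine h.left.ex_elim ?_
  have h' := Entails.hyp (fun p : (X.carrier × W.carrier) × Z.carrier =>
      conj (compRel (F.comp G) H p.1.1 p.1.2) (conj (compRel F G p.1.1 p.2) (H.rel p.2 p.1.2)))
    fun p y => conj (F.rel p.1.1 y) (G.rel y p.2)
  exact compRel_intro h'.left (compRel_intro (G := H) h'.right h.right.wk)

end FunRel

/-- The Herbrand topos: morphisms are equivalence classes of functional relations. -/
instance HerbrandTopos.category : Category.{u} (HerbrandTopos P) where
  Hom X Y := Quotient (FunRel.setoid X Y)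
  id X := Quotient.mk _ (FunRel.id X)
  comp := Quotient.map₂ FunRel.comp fun _ _ h _ _ h' =>
    ⟨FunRel.comp_le h.1 h'.1, FunRel.comp_le h.2 h'.2⟩
  id_comp := by
    rintro X Y ⟨F⟩
    exact Quotient.sound ⟨FunRel.id_comp_le F, FunRel.le_symm (FunRel.id_comp_le F)⟩
  comp_id := by
    rintro X Y ⟨F⟩
    exact Quotient.sound ⟨FunRel.comp_id_le F, FunRel.le_symm (FunRel.comp_id_le F)⟩
  assoc := by
    rintro X Y Z W ⟨F⟩ ⟨G⟩ ⟨H⟩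
    exact Quotient.sound ⟨FunRel.assoc_le F G H, FunRel.le_symm (FunRel.assoc_le F G H)⟩

/-- The morphism represented by a functional relation. -/
def FunRel.hom (F : FunRel X Y) : X ⟶ Y := Quotient.mk _ F

/-- The `Σ`-valued relation `R` is a functional relation representing the morphism `f`. -/
def HerbrandTopos.Represents (R : X.carrier → Y.carrier → HTruth P) (f : X ⟶ Y) : Prop :=
  ∃ F : FunRel X Y, F.rel = R ∧ F.hom = f

theorem FunRel.hom_eq {F G : FunRel X Y} (h : F.le G) : F.hom = G.hom :=
  Quotient.sound ⟨h, FunRel.le_symm h⟩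

theorem FunRel.exists_hom (f : X ⟶ Y) : ∃ F : FunRel X Y, F.hom = f := Quotient.exists_rep f

theorem FunRel.hom_comp (F : FunRel X Y) (G : FunRel Y Z) : F.hom ≫ G.hom = (F.comp G).hom := rfl

theorem FunRel.hom_id (X : HerbrandTopos P) : (FunRel.id X).hom = 𝟙 X := rfl

end

/-! ## The functors `∇` and `Γ` -/

section

variable {P : Type u} [PCA P] [Nontrivial P]

/-- The object `∇ Z`: the set `Z` with `[z = z] = (!P, P)`, and `[z = w] = (∅, P)` for `z ≠ w`. -/
def nablaObj (P : Type u) [PCA P] [Nontrivial P] (Z : Type u) : HerbrandTopos P where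
  carrier := Z
  eq z w := restrict (z = w) top
  eq_symm := Entails.restrict_top fun _ h => h.some_mem.2.symm
  eq_trans := Entails.restrict_top fun _ h => by
    obtain ⟨⟨_, h1⟩, ⟨_, h2⟩⟩ := act_nonempty_conj.1 h
    exact h1.2.trans h2.2

/-- The functional relation `F(z, w) = [f z = w]` from `∇ Z` to `∇ W`. -/
def nablaRel {Z W : Type u} (f : Z → W) : FunRel (nablaObj P Z) (nablaObj P W) where
  rel z w := restrict (f z = w) top
  strict := Entails.conj (Entails.restrict_top fun _ _ => rfl) (Entails.restrict_top fun _ _ => rfl)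
  congr := Entails.restrict_top fun _ h => by
    obtain ⟨⟨_, h1⟩, h23⟩ := act_nonempty_conj.1 h
    obtain ⟨⟨_, h2⟩, ⟨_, h3⟩⟩ := act_nonempty_conj.1 h23
    rw [← h2.2, h1.2, h3.2]
  single := Entails.restrict_top fun _ h => by
    obtain ⟨⟨_, h1⟩, ⟨_, h2⟩⟩ := act_nonempty_conj.1 h
    exact h1.2.symm.trans h2.2
  total := Entails.ex_intro f (Entails.restrict_top fun _ _ => rfl)

/-- The functor `∇` from sets to the Herbrand topos. -/
def nabla (P : Type u) [PCA P] [Nontrivial P] : Type u ⥤ HerbrandTopos P where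
  obj Z := nablaObj P Z
  map f := (nablaRel fun z => f z).hom
  map_id Z := FunRel.hom_eq (F := nablaRel _) (G := FunRel.id (nablaObj P Z))
    (Entails.restrict_top fun _ h => h.some_mem.2)
  map_comp {U V W} f g := (FunRel.hom_eq (F := (nablaRel fun z => f z).comp (nablaRel fun z => g z))
    (G := nablaRel fun z => g (f z)) (Entails.restrict_top fun _ h => by
      obtain ⟨y, hy⟩ := act_nonempty_ex.1 h
      obtain ⟨⟨_, h1⟩, ⟨_, h2⟩⟩ := act_nonempty_conj.1 hy
      rw [← h2.2, ← h1.2])).symm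

namespace HerbrandTopos

/-- `X₀ = {x ∈ X | [x = x]₀ is inhabited}`. -/
def Pt (X : HerbrandTopos P) : Type u := {x : X.carrier // (X.eq x x).act.Nonempty}

/-- `x ∼ x'` if `[x = x']₀` is inhabited. -/
instance ptSetoid (X : HerbrandTopos P) : Setoid X.Pt where
  r x x' := (X.eq x.1 x'.1).act.Nonempty
  iseqv := ⟨fun x => x.2, fun {x y} h => X.eq_symm.nonempty (x := (x.1, y.1)) h,
    fun {x y z} h h' => X.eq_trans.nonempty (x := (x.1, y.1, z.1))
      (act_nonempty_conj.2 ⟨h, h'⟩)⟩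

/-- The set `Γ (X, =) = X₀ / ∼`. -/
def GammaObj (X : HerbrandTopos P) : Type u := Quotient X.ptSetoid

end HerbrandTopos

open HerbrandTopos

variable {X Y Z : HerbrandTopos P}

theorem FunRel.nonempty_congr (F : FunRel X Y) {x x' : X.carrier} {y y' : Y.carrier}
    (h : (F.rel x y).act.Nonempty) (hx : (X.eq x x').act.Nonempty)
    (hy : (Y.eq y y').act.Nonempty) : (F.rel x' y').act.Nonempty :=
  F.congr.nonempty (x := ((x, x'), (y, y')))
    (act_nonempty_conj.2 ⟨h, act_nonempty_conj.2 ⟨hx, hy⟩⟩)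

theorem FunRel.nonempty_single (F : FunRel X Y) {x : X.carrier} {y y' : Y.carrier}
    (h : (F.rel x y).act.Nonempty) (h' : (F.rel x y').act.Nonempty) :
    (Y.eq y y').act.Nonempty :=
  F.single.nonempty (x := (x, y, y')) (act_nonempty_conj.2 ⟨h, h'⟩)

theorem FunRel.exists_pt (F : FunRel X Y) (x : X.Pt) :
    ∃ y : Y.Pt, (F.rel x.1 y.1).act.Nonempty := by
  obtain ⟨y, hy⟩ := act_nonempty_ex.1 (F.total.nonempty x.2)
  exact ⟨⟨y, (act_nonempty_conj.1 (F.strict.nonempty (x := (x.1, y)) hy)).2⟩, hy⟩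

/-- The function `[x] ↦ [y]`, where `F(x, y)₀` is inhabited. -/
noncomputable def FunRel.gamma (F : FunRel X Y) : X.GammaObj → Y.GammaObj :=
  Quotient.lift (fun x => Quotient.mk _ (F.exists_pt x).choose) fun x x' h =>
    Quotient.sound (F.nonempty_single
      (F.nonempty_congr (F.exists_pt x).choose_spec h (F.exists_pt x).choose.2)
      (F.exists_pt x').choose_spec)

theorem FunRel.gamma_mk (F : FunRel X Y) {x : X.Pt} {y : Y.Pt}
    (h : (F.rel x.1 y.1).act.Nonempty) :
    F.gamma (Quotient.mk _ x) = Quotient.mk _ y :=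
  Quotient.sound (F.nonempty_single (F.exists_pt x).choose_spec h)

theorem FunRel.gamma_eq {F G : FunRel X Y} (h : F.le G) : F.gamma = G.gamma := by
  funext c
  induction c using Quotient.inductionOn with
  | h x =>
    obtain ⟨y, hy⟩ := F.exists_pt x
    rw [F.gamma_mk hy, G.gamma_mk (h.nonempty (x := (x.1, y.1)) hy)]

/-- The action of `Γ` on morphisms. -/
noncomputable def gammaMap (f : X ⟶ Y) : X.GammaObj → Y.GammaObj :=
  Quotient.lift (s := FunRel.setoid X Y) FunRel.gamma (fun _ _ h => FunRel.gamma_eq h.1) f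

theorem gammaMap_hom (F : FunRel X Y) : gammaMap F.hom = F.gamma := rfl

theorem gammaMap_id (X : HerbrandTopos P) : gammaMap (𝟙 X) = fun c => c := by
  funext c
  induction c using Quotient.inductionOn with
  | h x => exact (FunRel.id X).gamma_mk x.2

theorem gammaMap_comp (f : X ⟶ Y) (g : Y ⟶ Z) :
    gammaMap (f ≫ g) = fun c => gammaMap g (gammaMap f c) := by
  obtain ⟨F, rfl⟩ := FunRel.exists_hom f
  obtain ⟨G, rfl⟩ := FunRel.exists_hom g
  funext c
  induction c using Quotient.inductionOn with
  | h x =>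
    obtain ⟨y, hy⟩ := F.exists_pt x
    obtain ⟨z, hz⟩ := G.exists_pt y
    rw [FunRel.hom_comp, gammaMap_hom, gammaMap_hom, gammaMap_hom]
    rw [F.gamma_mk hy, G.gamma_mk hz]
    exact (F.comp G).gamma_mk (act_nonempty_ex.2 ⟨y.1, act_nonempty_conj.2 ⟨hy, hz⟩⟩)

/-- The functor `Γ` from the Herbrand topos to sets. -/
noncomputable def Gamma (P : Type u) [PCA P] [Nontrivial P] : HerbrandTopos P ⥤ Type u where
  obj X := X.GammaObj
  map f := TypeCat.ofHom (gammaMap f)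
  map_id X := congrArg TypeCat.ofHom (gammaMap_id X)
  map_comp f g := congrArg TypeCat.ofHom (gammaMap_comp f g)

/-- The `Σ`-valued relation `H` from `(X, =)` to `∇ Γ (X, =)`: `H(x, c) = [x = x]` if `x ∈ c`, and
`(∅, [x = x]₁)` otherwise. -/
def unitRel (X : HerbrandTopos P) (x : X.carrier)
    (c : ((nabla P).obj ((Gamma P).obj X)).carrier) : HTruth P :=
  restrict (∃ h : (X.eq x x).act.Nonempty, c = Quotient.mk X.ptSetoid ⟨x, h⟩) (X.eq x x)

end

/-! ## Sheaves for the double negation topology -/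

section

/-- `b` is the pseudocomplement `¬ a` of `a` in a partial order: an element lies below `b` if and
only if its meet with `a` is the least element. -/
def IsPseudocomplement {α : Type*} [PartialOrder α] (a b : α) : Prop :=
  ∀ c, c ≤ b ↔ ∀ d, d ≤ a → d ≤ c → IsBot d

variable {C : Type*} [Category C]

/-- A monomorphism `m : A ⟶ B` is dense for the double negation topology if its closure `¬¬ A` is
the largest subobject of `B`. -/
def IsNotNotDense {A B : C} (m : A ⟶ B) [Mono m] : Prop :=
  ∃ n : Subobject B, IsPseudocomplement (Subobject.mk m) n ∧ IsPseudocomplement n ⊤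

/-- `X` is a sheaf for the double negation topology: every morphism to `X` from the domain of a
dense monomorphism extends uniquely along that monomorphism. -/
def IsNotNotSheaf : ObjectProperty C := fun X =>
  ∀ ⦃A B : C⦄ (m : A ⟶ B) [Mono m], IsNotNotDense m → ∀ g : A ⟶ X, ∃! h : B ⟶ X, m ≫ h = g

end

/-!
The tripos has two features that make double negation classical. Every set of codes `!A₁` contains
the empty sequence, so a family of truth values whose actual parts are all empty entails every other
family (`HTruth.Entails.of_isEmpty`): truth values without actual elements are false. On the other
hand, any family may be restricted to a condition that its actual elements imply without changing
realizers (`HTruth.Entails.restrict_intro`).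

The second feature shows that a functional relation `F` from `(X, =)` to `∇ S` is contained in,
hence equivalent to, the relation "`[x = x]`, restricted to the pairs `(x, s)` with `φ [x] = s`",
where `φ : Γ X → S` is the function induced by `F` on points. So morphisms `(X, =) ⟶ ∇ S` are
functions `Γ X → S` (`homNablaEquiv`), which is the adjunction `Γ ⊣ ∇`; its unit is the relation of
the identity function, and its counit is the bijection `Γ ∇ S ≃ S`, so `∇` is fully faithful.

Pullbacks are constructed on the product of the underlying sets, by the formula of regular logic. An
actual element of a conjunction or of an existential quantification exists as soon as it does for
the constituents, and so `Γ` sends this pullback to the pullback of sets.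

The first feature shows that an object with `Γ X` empty is initial. From here on only this, the
adjunction and the exactness of `Γ` matter. A subobject is least exactly if `Γ` makes it empty, and
therefore a monomorphism `m` is `¬¬`-dense exactly if `Γ m` is surjective, i.e. bijective
(`isNotNotDense_iff_surjective`). By adjunction `∇ S` is then a sheaf. Conversely, as `Γ` inverts
the unit of the adjunction, the diagonal of a sheaf in the kernel pair of its unit is dense; so the
unit is monic, it is dense, and it is an isomorphism (`isIso_unit_of_isNotNotSheaf`).
-/

/-! ### Double negation for a reflection onto sets -/

section Reflection

open Limits

variable {C : Type*} [Category C] {L : C ⥤ Type u} {R : Type u ⥤ C}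

theorem mono_of_isEmpty (hL : ∀ X : C, IsEmpty (L.obj X) → Nonempty (IsInitial X)) {X B : C}
    (hX : IsEmpty (L.obj X)) (f : X ⟶ B) : Mono f :=
  ⟨fun {W} g _ _ => by
    obtain ⟨hW⟩ := hL W ⟨fun x => hX.false (L.map g x)⟩
    exact hW.hom_ext _ _⟩

/-- The object `R.obj PEmpty` is initial and strict, so it gives every object a least subobject,
on which `L` is empty. -/
theorem isBot_iff_isEmpty (adj : L ⊣ R) [R.Full] [R.Faithful]
    (hL : ∀ X : C, IsEmpty (L.obj X) → Nonempty (IsInitial X)) {B : C} (d : Subobject B) :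
    IsBot d ↔ IsEmpty (L.obj (d : C)) := by
  have hE : IsEmpty (L.obj (R.obj PEmpty)) := ⟨fun x => (adj.counit.app PEmpty x).elim⟩
  constructor
  · intro h
    obtain ⟨hI⟩ := hL _ hE
    have := mono_of_isEmpty hL hE (hI.to B)
    exact ⟨fun x => hE.false (L.map (Subobject.ofLEMk d (hI.to B) (h _)) x)⟩
  · intro h c
    obtain ⟨hI⟩ := hL _ h
    exact Subobject.le_of_comm (hI.to _) (hI.hom_ext _ _)

/-- If `L.map m` missed a point of `L.obj B`, the pullback along the unit of the complement of its
image would be a nonzero subobject disjoint from `A`. Conversely, if `L.map m` is surjective, then a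
subobject disjoint from `A` has no points, so that `¬ A` is the least subobject. -/
theorem isNotNotDense_iff_surjective [HasFiniteLimits C] [PreservesFiniteLimits L] (adj : L ⊣ R)
    [R.Full] [R.Faithful] (hL : ∀ X : C, IsEmpty (L.obj X) → Nonempty (IsInitial X))
    {A B : C} (m : A ⟶ B) [Mono m] : IsNotNotDense m ↔ Function.Surjective (L.map m) := by
  constructor
  · rintro ⟨n, hn, hn'⟩ b
    by_contra hb
    -- the inclusion of the complement of the image of `L.map m`
    let S : Type u := {b : L.obj B // ∀ a, L.map m a ≠ b}
    let j : S ⟶ L.obj B := TypeCat.ofHom Subtype.val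
    have : Mono j := (mono_iff_injective j).2 Subtype.val_injective
    have := R.preservesMonomorphisms_of_adjunction adj
    let u : B ⟶ R.obj (L.obj B) := adj.unit.app B
    have sq := (IsPullback.of_hasPullback (R.map j) u).map L
    let c : Subobject B := Subobject.mk (pullback.snd (R.map j) u)
    let i : (c : C) ≅ pullback (R.map j) u := Subobject.underlyingIso _
    have hc : ∀ x : L.obj (c : C), ∀ a, L.map m a ≠ L.map c.arrow x := by
      intro x a e
      let y := adj.counit.app S (L.map (pullback.fst (R.map j) u)
        (L.map i.hom x))
      have h1 : L.map i.hom ≫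
          L.map (pullback.fst (R.map j) u) ≫ adj.counit.app S ≫ j =
          L.map c.arrow := by
        have := adj.counit.naturality j
        simp only [Functor.comp_map, Functor.id_map] at this
        rw [← this, ← L.map_comp_assoc _ (R.map j), pullback.condition, L.map_comp_assoc,
          adj.left_triangle_components, Category.comp_id, ← L.map_comp]
        exact congrArg L.map (Subobject.underlyingIso_hom_comp_eq_mk _)
      exact y.2 a (e.trans (congrArg (fun f => f x) h1).symm)
    have hbot : IsBot c := by
      refine (hn' c).1 le_top c ((hn c).2 fun d hd hdc => ?_) le_rfl
      refine (isBot_iff_isEmpty adj hL d).2 ⟨fun x => ?_⟩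
      refine hc (L.map (Subobject.ofLE d c hdc) x) (L.map (Subobject.ofLEMk d m hd) x) ?_
      rw [← ConcreteCategory.comp_apply, ← ConcreteCategory.comp_apply, ← L.map_comp,
        ← L.map_comp, Subobject.ofLEMk_comp, Subobject.ofLE_arrow]
    rw [isBot_iff_isEmpty adj hL] at hbot
    -- the complement is inhabited by `b`, which lifts to the pullback
    have hs := (isIso_iff_bijective _).1 (inferInstance : IsIso (adj.counit.app S))
    obtain ⟨s, hs⟩ := hs.2 ⟨b, fun a ha => hb ⟨a, ha⟩⟩
    have hu := (isIso_iff_bijective _).1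
      (inferInstance : IsIso (adj.counit.app (L.obj B)))
    obtain ⟨x, -, -⟩ := Types.exists_of_isPullback sq s b (hu.1 (by
      have h1 := congrArg (fun f => f s) (adj.counit.naturality j)
      have h2 := congrArg (fun f => f b) (adj.left_triangle_components B)
      simp only [Functor.comp_map, Functor.id_map, ConcreteCategory.comp_apply, hs] at h1
      exact h1.trans h2.symm))
    exact hbot.false (L.map i.inv x)
  · intro h
    have hE : IsEmpty (L.obj (R.obj PEmpty)) := ⟨fun x => (adj.counit.app PEmpty x).elim⟩
    obtain ⟨hI⟩ := hL _ hE
    have := mono_of_isEmpty hL hE (hI.to B)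
    have hbot : IsBot (Subobject.mk (hI.to B)) := (isBot_iff_isEmpty adj hL _).2
      ⟨fun x => hE.false (L.map (Subobject.underlyingIso _).hom x)⟩
    refine ⟨Subobject.mk (hI.to B), fun c => ⟨fun hc d _ hd e => (hd.trans hc).trans (hbot e),
      fun hc => ?_⟩, fun c => ⟨fun _ d hd _ e => hd.trans (hbot e), fun _ => le_top⟩⟩
    refine (isBot_iff_isEmpty adj hL c).2 ⟨fun x => ?_⟩ _
    obtain ⟨a, ha⟩ := h (L.map c.arrow x)
    obtain ⟨y, -, -⟩ := Types.exists_of_isPullback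
      ((IsPullback.of_hasPullback m c.arrow).map L) a x ha
    have hd := hc (Subobject.mk (pullback.fst m c.arrow ≫ m))
      (Subobject.mk_le_mk_of_comm (pullback.fst m c.arrow) rfl)
      (Subobject.mk_le_of_comm (pullback.snd m c.arrow) pullback.condition.symm)
    exact ((isBot_iff_isEmpty adj hL _).1 hd).false (L.map (Subobject.underlyingIso _).inv y)

theorem isIso_map_of_isNotNotDense [HasFiniteLimits C] [PreservesFiniteLimits L] (adj : L ⊣ R)
    [R.Full] [R.Faithful] (hL : ∀ X : C, IsEmpty (L.obj X) → Nonempty (IsInitial X))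
    {A B : C} (m : A ⟶ B) [Mono m] (hm : IsNotNotDense m) : IsIso (L.map m) :=
  (isIso_iff_bijective _).2 ⟨(mono_iff_injective _).1 inferInstance,
    (isNotNotDense_iff_surjective adj hL m).1 hm⟩

theorem isNotNotSheaf_of_iso [HasFiniteLimits C] [PreservesFiniteLimits L] (adj : L ⊣ R)
    [R.Full] [R.Faithful] (hL : ∀ X : C, IsEmpty (L.obj X) → Nonempty (IsInitial X))
    {X : C} {Z : Type u} (e : X ≅ R.obj Z) : IsNotNotSheaf X := by
  intro A B m _ hm g
  have := isIso_map_of_isNotNotDense adj hL m hm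
  refine ⟨adj.homEquiv _ _ (inv (L.map m) ≫ (adj.homEquiv _ _).symm (g ≫ e.hom)) ≫ e.inv, ?_,
    fun h hh => ?_⟩
  · simp only
    rw [← Category.assoc, ← adj.homEquiv_naturality_left, IsIso.hom_inv_id_assoc,
      Equiv.apply_symm_apply, Category.assoc, e.hom_inv_id, Category.comp_id]
  · rw [← hh, Iso.eq_comp_inv, Category.assoc, adj.homEquiv_naturality_left_symm,
      IsIso.inv_hom_id_assoc, Equiv.apply_symm_apply]

/-- The diagonal of `X` in the kernel pair of the unit is dense, since `L` inverts the unit; so the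
unit of a sheaf is monic. As a dense monomorphism between sheaves it is invertible. -/
theorem isIso_unit_of_isNotNotSheaf [HasFiniteLimits C] [PreservesFiniteLimits L] (adj : L ⊣ R)
    [R.Full] [R.Faithful] (hL : ∀ X : C, IsEmpty (L.obj X) → Nonempty (IsInitial X))
    {X : C} (hX : IsNotNotSheaf X) : IsIso (adj.unit.app X) := by
  let u : X ⟶ R.obj (L.obj X) := adj.unit.app X
  have hu := (isIso_iff_bijective _).1 (inferInstance : IsIso (L.map u))
  have hdiag : IsNotNotDense (pullback.diagonal u) := by
    refine (isNotNotDense_iff_surjective adj hL _).2 fun y => ⟨L.map (pullback.fst u u) y, ?_⟩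
    have sq := (IsPullback.of_hasPullback u u).map L
    have e : L.map (pullback.fst u u) y = L.map (pullback.snd u u) y :=
      hu.1 (congrArg (fun f => f y) sq.w)
    apply Types.ext_of_isPullback sq
    · rw [← ConcreteCategory.comp_apply (L.map (pullback.diagonal u)), ← L.map_comp,
        pullback.diagonal_fst, L.map_id]
      rfl
    · rw [← ConcreteCategory.comp_apply (L.map (pullback.diagonal u)), ← L.map_comp,
        pullback.diagonal_snd, L.map_id]
      exact e
  have hfst : pullback.fst u u = pullback.snd u u :=
    (hX _ hdiag (𝟙 X)).unique (pullback.diagonal_fst u) (pullback.diagonal_snd u)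
  have : Mono u := ⟨fun g h e => by
    rw [← pullback.lift_fst g h e, hfst, pullback.lift_snd]⟩
  have hd : IsNotNotDense u := (isNotNotDense_iff_surjective adj hL u).2 hu.2
  obtain ⟨h, hh, -⟩ := hX u hd (𝟙 X)
  refine ⟨h, hh, (isNotNotSheaf_of_iso adj hL (Iso.refl _) u hd u).unique ?_ (Category.comp_id _)⟩
  change u ≫ h ≫ u = u
  rw [← Category.assoc, hh, Category.id_comp]

end Reflection

/-! ### Further rules of the tripos -/

open PCA HTruth HerbrandTopos

namespace HTruth.Entails

variable {P : Type u} [PCA P] [Nontrivial P] {I : Type u} {χ φ : I → HTruth P}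

/-- A family without actual elements entails everything: the empty sequence is a potential element
of every truth value. -/
theorem of_isEmpty (h : ∀ i, ¬ (χ i).act.Nonempty) : Entails χ φ :=
  ⟨ka (code []), fun i => tracks_iff.2 fun l _ =>
    ⟨[], app_ka _ _, by simp, fun hl => (h i ⟨_, hl⟩).elim⟩⟩

theorem restrict_intro {p : I → Prop} (h : Entails χ φ) (hp : ∀ i, (χ i).act.Nonempty → p i) :
    Entails χ fun i => restrict (p i) (φ i) := by
  obtain ⟨r, hr⟩ := h
  refine ⟨r, fun i => ⟨(hr i).1, fun n hn => ?_⟩⟩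
  obtain ⟨m, hm, h'⟩ := (hr i).2 n hn
  exact ⟨m, hm, h', hp i ⟨n, hn⟩⟩

theorem of_restrict {p : I → Prop} (h : Entails χ fun i => restrict (p i) (φ i)) :
    Entails χ φ :=
  h.trans ⟨PCA.i, fun _ => ⟨fun n hn => ⟨n, by simp [app_i], hn⟩,
    fun n hn => ⟨n, by simp [app_i], hn.1⟩⟩⟩

end HTruth.Entails

section

open Limits

variable {P : Type u} [PCA P] [Nontrivial P] {X Y Z W : HerbrandTopos P} {I : Type u}
  {χ : I → HTruth P}

namespace FunRel

theorem hom_eq_iff {F G : FunRel X Y} : F.hom = G.hom ↔ F.le G :=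
  ⟨fun h => (Quotient.exact h).1, hom_eq⟩

/-! ### Objects without global points -/

/-- The functional relation with no actual elements, from an object without global points. -/
def ofIsEmpty (hX : IsEmpty X.GammaObj) (Y : HerbrandTopos P) : FunRel X Y where
  rel _ _ := restrict False top
  strict := .of_isEmpty fun _ h => h.some_mem.2
  congr := .of_isEmpty fun _ h => (act_nonempty_conj.1 h).1.some_mem.2
  single := .of_isEmpty fun _ h => (act_nonempty_conj.1 h).1.some_mem.2
  total := .of_isEmpty fun x h => hX.false (Quotient.mk _ ⟨x, h⟩)

end FunRel

theorem HerbrandTopos.isInitial_of_isEmpty (X : HerbrandTopos P)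
    (hX : IsEmpty ((Gamma P).obj X)) : Nonempty (IsInitial X) :=
  ⟨IsInitial.ofUniqueHom (fun Y => (FunRel.ofIsEmpty hX Y).hom) fun Y f => by
    obtain ⟨F, rfl⟩ := FunRel.exists_hom f
    exact FunRel.hom_eq (.of_isEmpty fun p h => hX.false (Quotient.mk _
      ⟨p.1, (act_nonempty_conj.1 (F.strict.nonempty (x := p) h)).1⟩))⟩

namespace FunRel

/-! ### Morphisms to constant objects -/

/-- The functional relation to `∇ Z` that corresponds to a function `φ : Γ X → Z` under the
adjunction. -/
def transpose {S : Type u} (φ : X.GammaObj → S) : FunRel X (nablaObj P S) where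
  rel x z := restrict (∃ h : (X.eq x x).act.Nonempty, z = φ (Quotient.mk X.ptSetoid ⟨x, h⟩))
    (X.eq x x)
  strict := (Entails.refl _).of_restrict.conj (Entails.restrict_top fun _ _ => rfl)
  congr := by
    have h := Entails.refl
      fun p : (X.carrier × X.carrier) × (nablaObj P S).carrier × (nablaObj P S).carrier =>
        conj (restrict (∃ h : (X.eq p.1.1 p.1.1).act.Nonempty,
            p.2.1 = φ (Quotient.mk X.ptSetoid ⟨p.1.1, h⟩)) (X.eq p.1.1 p.1.1))
          (conj (X.eq p.1.1 p.1.2) ((nablaObj P S).eq p.2.1 p.2.2))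
    refine (right' h.right.left).restrict_intro fun p hp => ?_
    have h' := (right' h.right.left).nonempty hp
    obtain ⟨⟨_, -, h1, e⟩, hp⟩ := act_nonempty_conj.1 hp
    obtain ⟨h2, ⟨_, -, h3⟩⟩ := act_nonempty_conj.1 hp
    exact ⟨h', h3.symm.trans (e.trans (congrArg φ (Quotient.sound h2)))⟩
  single := Entails.restrict_top fun p hp => by
    obtain ⟨⟨_, -, h1, e1⟩, ⟨_, -, h2, e2⟩⟩ := act_nonempty_conj.1 hp
    exact e1.trans e2.symm
  total := by
    classical
    by_cases hX : IsEmpty X.GammaObj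
    · exact .of_isEmpty fun x h => hX.false (Quotient.mk _ ⟨x, h⟩)
    · have : Nonempty S := (not_isEmpty_iff.1 hX).map φ
      refine Entails.ex_intro (fun x => if h : (X.eq x x).act.Nonempty then
        φ (Quotient.mk X.ptSetoid ⟨x, h⟩) else Classical.arbitrary S)
        ((Entails.refl _).restrict_intro fun x h => ⟨h, dif_pos h⟩)

end FunRel

/-- The bijection `Γ ∇ S ≃ S`. -/
def gammaNablaEquiv (P : Type u) [PCA P] [Nontrivial P] (S : Type u) :
    (nablaObj P S).GammaObj ≃ S where
  toFun := Quotient.lift (fun z => z.1) fun _ _ h => h.some_mem.2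
  invFun z := Quotient.mk _ ⟨z, code [], ⟨[], by simp, rfl⟩, rfl⟩
  left_inv c := by
    induction c using Quotient.inductionOn with
    | h z => rfl
  right_inv _ := rfl

/-- Evaluation at the global points determines a morphism to `∇ S`, since a functional relation `F`
to `∇ S` is contained in the transpose of the function that it induces on points. -/
noncomputable def homNablaEquiv (X : HerbrandTopos P) (S : Type u) :
    (X ⟶ nablaObj P S) ≃ (X.GammaObj → S) where
  toFun f c := gammaNablaEquiv P S (gammaMap f c)
  invFun φ := (FunRel.transpose φ).hom
  left_inv f := by
    obtain ⟨F, rfl⟩ := FunRel.exists_hom f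
    refine (FunRel.hom_eq ?_).symm
    refine (F.strict_left (Entails.refl _)).restrict_intro fun p hp => ?_
    have h := act_nonempty_conj.1 (F.strict.nonempty (x := p) hp)
    exact ⟨h.1, (congrArg (gammaNablaEquiv P S)
      (F.gamma_mk (x := ⟨p.1, h.1⟩) (y := ⟨p.2, h.2⟩) hp)).symm⟩
  right_inv φ := by
    funext c
    induction c using Quotient.inductionOn with
    | h x =>
      have hy : ((nablaObj P S).eq (φ (Quotient.mk _ x)) (φ (Quotient.mk _ x))).act.Nonempty :=
        ⟨code [], ⟨[], by simp, rfl⟩, rfl⟩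
      exact congrArg (gammaNablaEquiv P S) ((FunRel.transpose φ).gamma_mk (x := x) (y := ⟨_, hy⟩)
        ⟨_, x.2.some_mem, x.2, rfl⟩)

theorem gammaNablaEquiv_gammaMap {S T : Type u} (g : S ⟶ T) (c : (nablaObj P S).GammaObj) :
    gammaNablaEquiv P T (gammaMap ((nabla P).map g) c) = g (gammaNablaEquiv P S c) := by
  obtain ⟨z, rfl⟩ := (gammaNablaEquiv P S).symm.surjective c
  have hz : ((nablaObj P T).eq (g z) (g z)).act.Nonempty := ⟨code [], ⟨[], by simp, rfl⟩, rfl⟩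
  exact congrArg (gammaNablaEquiv P T) ((nablaRel (P := P) fun z => g z).gamma_mk
    (y := ⟨g z, hz⟩) ⟨code [], ⟨[], by simp, rfl⟩, rfl⟩)

/-- The isomorphism `Γ ∇ ≅ 1`. -/
noncomputable def gammaNablaIso (P : Type u) [PCA P] [Nontrivial P] :
    nabla P ⋙ Gamma P ≅ 𝟭 (Type u) :=
  NatIso.ofComponents (fun S => (gammaNablaEquiv P S).toIso) fun g => by
    ext c
    exact gammaNablaEquiv_gammaMap g c

/-- The adjunction `Γ ⊣ ∇`. -/
noncomputable def gammaNablaAdj (P : Type u) [PCA P] [Nontrivial P] : Gamma P ⊣ nabla P :=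
  Adjunction.mkOfHomEquiv
    { homEquiv := fun X S =>
        { toFun := fun φ => (homNablaEquiv X S).symm fun c => φ c
          invFun := fun f => TypeCat.ofHom (homNablaEquiv X S f)
          left_inv := fun φ => by
            ext c
            exact congrFun ((homNablaEquiv X S).apply_symm_apply _) c
          right_inv := fun f => (homNablaEquiv X S).symm_apply_apply f }
      homEquiv_naturality_left_symm := fun f g => by
        ext c
        exact congrArg (gammaNablaEquiv P _) (congrFun (gammaMap_comp f g) c)
      homEquiv_naturality_right := fun {X S T} φ g => by
        refine (homNablaEquiv X T).symm_apply_eq.2 (funext fun c => ?_)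
        have h := congrFun ((homNablaEquiv X S).apply_symm_apply fun c => φ c) c
        refine (congrArg g h.symm).trans ?_
        refine (gammaNablaEquiv_gammaMap g _).symm.trans (congrArg (gammaNablaEquiv P T) ?_)
        exact (congrFun (gammaMap_comp ((homNablaEquiv X S).symm fun c => φ c)
          ((nabla P).map g)) c).symm }

theorem gammaNablaAdj_unit (X : HerbrandTopos P) :
    Represents (unitRel X) ((gammaNablaAdj P).unit.app X) :=
  ⟨FunRel.transpose fun c => c, rfl, by
    rw [← Adjunction.homEquiv_id, gammaNablaAdj, Adjunction.mkOfHomEquiv_homEquiv]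
    rfl⟩

instance : IsIso (gammaNablaAdj P).counit := by
  have : ∀ S, IsIso ((gammaNablaAdj P).counit.app S) := fun S => by
    have h : (gammaNablaAdj P).counit.app S = (gammaNablaIso P).hom.app S := by
      rw [← Adjunction.homEquiv_symm_id, gammaNablaAdj, Adjunction.mkOfHomEquiv_homEquiv]
      ext c
      exact congrArg (gammaNablaEquiv P S) (congrFun (gammaMap_id _) c)
    rw [h]
    infer_instance
  exact NatIso.isIso_of_isIso_app _

instance : (nabla P).Full := (gammaNablaAdj P).fullyFaithfulROfIsIsoCounit.full

instance : (nabla P).Faithful := (gammaNablaAdj P).fullyFaithfulROfIsIsoCounit.faithful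

/-! ### Finite limits -/

namespace FunRel

/-- The functional relation `[x = x] ∧ [f x = y]` given by a function `f` on underlying sets that
respects equality. -/
def ofFun (f : X.carrier → Y.carrier)
    (hf : Entails (fun p : X.carrier × X.carrier => X.eq p.1 p.2) fun p => Y.eq (f p.1) (f p.2)) :
    FunRel X Y where
  rel x y := conj (X.eq x x) (Y.eq (f x) y)
  strict :=
    have h := Entails.refl fun p : X.carrier × Y.carrier => conj (X.eq p.1 p.1) (Y.eq (f p.1) p.2)
    h.left.conj (right' h.right)
  congr := by
    have h := Entails.refl fun p : (X.carrier × X.carrier) × Y.carrier × Y.carrier =>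
      conj (conj (X.eq p.1.1 p.1.1) (Y.eq (f p.1.1) p.2.1))
        (conj (X.eq p.1.1 p.1.2) (Y.eq p.2.1 p.2.2))
    have hx := h.right.left
    exact (right' hx).conj (trans' (symm' (hx.trans
      (hf.reindex fun p : (X.carrier × X.carrier) × Y.carrier × Y.carrier => p.1)))
      (trans' h.left.right h.right.right))
  single := by
    have h := Entails.refl fun p : X.carrier × Y.carrier × Y.carrier =>
      conj (conj (X.eq p.1 p.1) (Y.eq (f p.1) p.2.1)) (conj (X.eq p.1 p.1) (Y.eq (f p.1) p.2.2))
    exact trans' (symm' h.left.right) h.right.right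
  total := Entails.ex_intro f
    ((Entails.refl _).conj ((Entails.refl _).trans (hf.reindex fun x => (x, x))))

variable (F : FunRel X Z) (G : FunRel Y Z)

/-- The relation `∃ z, F(x, z) ∧ G(y, z)`. -/
def agree (x : X.carrier) (y : Y.carrier) : HTruth P :=
  ex fun z => conj (F.rel x z) (G.rel y z)

variable {F G}

theorem agree_congr {a a' : I → X.carrier} {b b' : I → Y.carrier}
    (h : Entails χ fun i => agree F G (a i) (b i)) (ha : Entails χ fun i => X.eq (a i) (a' i))
    (hb : Entails χ fun i => Y.eq (b i) (b' i)) : Entails χ fun i => agree F G (a' i) (b' i) := by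
  refine h.ex_elim ?_
  have h' := Entails.hyp χ fun i z => conj (F.rel (a i) z) (G.rel (b i) z)
  have hz := F.strict_right h'.left
  exact Entails.ex_intro Prod.snd ((F.congr' h'.left ha.wk hz).conj (G.congr' h'.right hb.wk hz))

theorem agree_single {a : I → X.carrier} {b : I → Y.carrier} {c : I → Z.carrier}
    (h : Entails χ fun i => agree F G (a i) (b i)) (hF : Entails χ fun i => F.rel (a i) (c i)) :
    Entails χ fun i => G.rel (b i) (c i) := by
  refine h.ex_elim ?_
  have h' := Entails.hyp χ fun i z => conj (F.rel (a i) z) (G.rel (b i) z)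
  exact G.congr' h'.right (G.strict_left h'.right) (F.single' h'.left hF.wk)

theorem agree_of_comp_le {S : FunRel W X} {T : FunRel W Y} (hle : (S.comp F).le (T.comp G))
    {a : I → W.carrier} {b : I → X.carrier} {c : I → Y.carrier}
    (hS : Entails χ fun i => S.rel (a i) (b i)) (hT : Entails χ fun i => T.rel (a i) (c i)) :
    Entails χ fun i => agree F G (b i) (c i) := by
  refine (F.total' (S.strict_right hS)).ex_elim ?_
  have hF := Entails.hyp χ fun i z => F.rel (b i) z
  have hc : Entails (fun p : I × Z.carrier => conj (χ p.1) (F.rel (b p.1) p.2))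
      fun p => compRel T G (a p.1) p.2 :=
    (compRel_intro hS.wk hF).trans (hle.reindex fun p : I × Z.carrier => (a p.1, p.2))
  have hT' := hT.wk (φ' := fun p : I × Z.carrier => F.rel (b p.1) p.2)
  refine hc.ex_elim ?_
  have h := Entails.hyp (fun p : I × Z.carrier => conj (χ p.1) (F.rel (b p.1) p.2))
    fun p y => conj (T.rel (a p.1) y) (G.rel y p.2)
  exact Entails.ex_intro (fun p => p.1.2) (hF.wk.conj
    (G.congr' h.right (T.single' h.left hT'.wk) (G.strict_right h.right)))

variable (F G)

/-- The pullback of `F` and `G`: the set `X × Y`, where `(x, y)` equals `(x', y')` to the extent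
that `x = x'`, `y = y'`, and `F` and `G` agree at `(x, y)`. -/
def pullbackObj : HerbrandTopos P where
  carrier := X.carrier × Y.carrier
  eq p q := conj (conj (X.eq p.1 q.1) (Y.eq p.2 q.2)) (agree F G p.1 p.2)
  eq_symm := by
    have h := Entails.refl fun p : (X.carrier × Y.carrier) × X.carrier × Y.carrier =>
      conj (conj (X.eq p.1.1 p.2.1) (Y.eq p.1.2 p.2.2)) (agree F G p.1.1 p.1.2)
    exact ((symm' h.left.left).conj (symm' h.left.right)).conj
      (agree_congr h.right h.left.left h.left.right)
  eq_trans := by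
    have h := Entails.refl fun p : (X.carrier × Y.carrier) × (X.carrier × Y.carrier) ×
        X.carrier × Y.carrier =>
      conj (conj (conj (X.eq p.1.1 p.2.1.1) (Y.eq p.1.2 p.2.1.2)) (agree F G p.1.1 p.1.2))
        (conj (conj (X.eq p.2.1.1 p.2.2.1) (Y.eq p.2.1.2 p.2.2.2)) (agree F G p.2.1.1 p.2.1.2))
    exact ((trans' h.left.left.left h.right.left.left).conj
      (trans' h.left.left.right h.right.left.right)).conj h.left.right

/-- The first projection of the pullback. -/
def pullbackFst : FunRel (pullbackObj F G) X :=
  ofFun Prod.fst (Entails.refl fun p : (pullbackObj F G).carrier × (pullbackObj F G).carrier =>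
    (pullbackObj F G).eq p.1 p.2).left.left

/-- The second projection of the pullback. -/
def pullbackSnd : FunRel (pullbackObj F G) Y :=
  ofFun Prod.snd (Entails.refl fun p : (pullbackObj F G).carrier × (pullbackObj F G).carrier =>
    (pullbackObj F G).eq p.1 p.2).left.right

theorem pullback_condition : ((pullbackFst F G).comp F).le ((pullbackSnd F G).comp G) := by
  refine (Entails.refl _).ex_elim ?_
  have h := Entails.hyp (fun p : (pullbackObj F G).carrier × Z.carrier =>
    compRel (pullbackFst F G) F p.1 p.2) fun p x => conj ((pullbackFst F G).rel p.1 x) (F.rel x p.2)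
  have he : Entails _ fun p : ((pullbackObj F G).carrier × Z.carrier) × X.carrier =>
    (pullbackObj F G).eq p.1.1 p.1.1 := h.left.left
  have hx : Entails _ fun p : ((pullbackObj F G).carrier × Z.carrier) × X.carrier =>
    X.eq p.1.1.1 p.2 := h.left.right
  have ha : Entails _ fun p : ((pullbackObj F G).carrier × Z.carrier) × X.carrier =>
    agree F G p.1.1.1 p.1.1.2 := he.right
  have hF : Entails _ fun p : ((pullbackObj F G).carrier × Z.carrier) × X.carrier =>
    F.rel p.1.1.1 p.1.2 := F.congr' h.right (symm' hx) (F.strict_right h.right)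
  have hG := agree_single ha hF
  exact compRel_intro (F := pullbackSnd F G) (he.conj he.left.right) hG

variable {F G}

/-- The morphism to the pullback induced by `S` and `T`. -/
def pullbackLift (S : FunRel W X) (T : FunRel W Y) (hle : (S.comp F).le (T.comp G)) :
    FunRel W (pullbackObj F G) where
  rel w p := conj (S.rel w p.1) (T.rel w p.2)
  strict := by
    have h := Entails.refl fun p : W.carrier × X.carrier × Y.carrier =>
      conj (S.rel p.1 p.2.1) (T.rel p.1 p.2.2)
    exact (S.strict_left h.left).conj (((S.strict_right h.left).conj (T.strict_right h.right)).conj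
      (agree_of_comp_le hle h.left h.right))
  congr := by
    have h := Entails.refl fun p : (W.carrier × W.carrier) × (X.carrier × Y.carrier) ×
        X.carrier × Y.carrier =>
      conj (conj (S.rel p.1.1 p.2.1.1) (T.rel p.1.1 p.2.1.2))
        (conj (W.eq p.1.1 p.1.2) ((pullbackObj F G).eq p.2.1 p.2.2))
    exact (S.congr' h.left.left h.right.left h.right.right.left.left).conj
      (T.congr' h.left.right h.right.left h.right.right.left.right)
  single := by
    have h := Entails.refl fun p : W.carrier × (X.carrier × Y.carrier) × X.carrier × Y.carrier =>
      conj (conj (S.rel p.1 p.2.1.1) (T.rel p.1 p.2.1.2))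
        (conj (S.rel p.1 p.2.2.1) (T.rel p.1 p.2.2.2))
    exact ((S.single' h.left.left h.right.left).conj (T.single' h.left.right h.right.right)).conj
      (agree_of_comp_le hle h.left.left h.left.right)
  total := by
    refine (S.total' (Entails.refl _)).ex_elim ?_
    have h1 := Entails.hyp (fun w : W.carrier => W.eq w w) fun w x => S.rel w x
    refine (T.total' (S.strict_left h1)).ex_elim ?_
    have h2 := Entails.hyp (fun p : W.carrier × X.carrier => conj (W.eq p.1 p.1) (S.rel p.1 p.2))
      fun p y => T.rel p.1 y
    exact Entails.ex_intro (fun p => (p.1.2, p.2)) (h1.wk.conj h2)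

theorem pullbackLift_fst (S : FunRel W X) (T : FunRel W Y) (hle : (S.comp F).le (T.comp G)) :
    ((pullbackLift S T hle).comp (pullbackFst F G)).le S := by
  refine (Entails.refl _).ex_elim ?_
  have h := Entails.hyp (fun p : W.carrier × X.carrier =>
    compRel (pullbackLift S T hle) (pullbackFst F G) p.1 p.2)
    fun p q => conj ((pullbackLift S T hle).rel p.1 q) ((pullbackFst F G).rel q p.2)
  exact S.congr' h.left.left (S.strict_left h.left.left) h.right.right

theorem pullbackLift_snd (S : FunRel W X) (T : FunRel W Y) (hle : (S.comp F).le (T.comp G)) :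
    ((pullbackLift S T hle).comp (pullbackSnd F G)).le T := by
  refine (Entails.refl _).ex_elim ?_
  have h := Entails.hyp (fun p : W.carrier × Y.carrier =>
    compRel (pullbackLift S T hle) (pullbackSnd F G) p.1 p.2)
    fun p q => conj ((pullbackLift S T hle).rel p.1 q) ((pullbackSnd F G).rel q p.2)
  exact T.congr' h.left.right (T.strict_left h.left.right) h.right.right

theorem le_of_comp_pullback_le {H H' : FunRel W (pullbackObj F G)}
    (h1 : (H.comp (pullbackFst F G)).le (H'.comp (pullbackFst F G)))
    (h2 : (H.comp (pullbackSnd F G)).le (H'.comp (pullbackSnd F G))) : H.le H' := by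
  have h := Entails.refl fun p : W.carrier × (pullbackObj F G).carrier => H.rel p.1 p.2
  have he := H.strict_right h
  have hf : Entails _ fun p : W.carrier × (pullbackObj F G).carrier =>
    (pullbackFst F G).rel p.2 p.2.1 := he.conj he.left.left
  have hs : Entails _ fun p : W.carrier × (pullbackObj F G).carrier =>
    (pullbackSnd F G).rel p.2 p.2.2 := he.conj he.left.right
  have hx := (compRel_intro h hf).trans
    (h1.reindex fun p : W.carrier × (pullbackObj F G).carrier => (p.1, p.2.1))
  have hy := (compRel_intro h hs).trans
    (h2.reindex fun p : W.carrier × (pullbackObj F G).carrier => (p.1, p.2.2))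
  refine hx.ex_elim ?_
  have k1 := Entails.hyp (fun p : W.carrier × (pullbackObj F G).carrier => H.rel p.1 p.2)
    fun p q => conj (H'.rel p.1 q) ((pullbackFst F G).rel q p.2.1)
  refine hy.wk.ex_elim ?_
  have k1' := k1.wk (φ' := fun p => conj (H'.rel p.1.1.1 p.2) ((pullbackSnd F G).rel p.2 p.1.1.2.2))
  have k2 := Entails.hyp
    (fun p : (W.carrier × (pullbackObj F G).carrier) × (pullbackObj F G).carrier =>
      conj (H.rel p.1.1 p.1.2) (conj (H'.rel p.1.1 p.2) ((pullbackFst F G).rel p.2 p.1.2.1)))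
    fun p q => conj (H'.rel p.1.1 q) ((pullbackSnd F G).rel q p.1.2.2)
  have hq := H'.single' k1'.left k2.left
  have hx' : Entails _ fun p : ((W.carrier × (pullbackObj F G).carrier) ×
    (pullbackObj F G).carrier) × (pullbackObj F G).carrier => X.eq p.1.2.1 p.1.1.2.1 :=
    k1'.right.right
  have hy' : Entails _ fun p : ((W.carrier × (pullbackObj F G).carrier) ×
    (pullbackObj F G).carrier) × (pullbackObj F G).carrier => Y.eq p.1.2.2 p.1.1.2.2 :=
    trans' hq.left.right k2.right.right
  exact H'.congr' k1'.left (H'.strict_left k1'.left) ((hx'.conj hy').conj hq.right)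

variable (F G)

theorem isPullback : IsPullback (pullbackFst F G).hom (pullbackSnd F G).hom F.hom G.hom := by
  refine ⟨⟨hom_eq (pullback_condition F G)⟩, ⟨PullbackCone.isLimitAux' _ fun s => ?_⟩⟩
  refine Classical.choice ?_
  obtain ⟨S, hS⟩ := exists_hom s.fst
  obtain ⟨T, hT⟩ := exists_hom s.snd
  have hle : (S.comp F).le (T.comp G) := hom_eq_iff.1 (by
    rw [← hom_comp, ← hom_comp, hS, hT, s.condition])
  have e1 := hom_eq (pullbackLift_fst S T hle)
  have e2 := hom_eq (pullbackLift_snd S T hle)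
  refine ⟨(pullbackLift S T hle).hom, e1.trans hS, e2.trans hT, fun {m} h1 h2 => ?_⟩
  obtain ⟨M, rfl⟩ := exists_hom m
  exact hom_eq (le_of_comp_pullback_le (hom_eq_iff.1 ((h1.trans hS.symm).trans e1.symm))
    (hom_eq_iff.1 ((h2.trans hT.symm).trans e2.symm)))

theorem isPullback_gamma : IsPullback ((Gamma P).map (pullbackFst F G).hom)
    ((Gamma P).map (pullbackSnd F G).hom) ((Gamma P).map F.hom) ((Gamma P).map G.hom) := by
  have hfst : ∀ p : (pullbackObj F G).Pt, (pullbackFst F G).gamma (Quotient.mk _ p) =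
      Quotient.mk _ ⟨p.1.1, (act_nonempty_conj.1 (act_nonempty_conj.1 p.2).1).1⟩ := fun p =>
    (pullbackFst F G).gamma_mk (act_nonempty_conj.2
      ⟨p.2, (act_nonempty_conj.1 (act_nonempty_conj.1 p.2).1).1⟩)
  have hsnd : ∀ p : (pullbackObj F G).Pt, (pullbackSnd F G).gamma (Quotient.mk _ p) =
      Quotient.mk _ ⟨p.1.2, (act_nonempty_conj.1 (act_nonempty_conj.1 p.2).1).2⟩ := fun p =>
    (pullbackSnd F G).gamma_mk (act_nonempty_conj.2
      ⟨p.2, (act_nonempty_conj.1 (act_nonempty_conj.1 p.2).1).2⟩)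
  refine (Types.isPullback_iff _ _ _ _).2
    ⟨((Gamma P).map_comp _ _).symm.trans ((congrArg (Gamma P).map (isPullback F G).w).trans
      ((Gamma P).map_comp _ _)), fun c d => ?_, fun c d => ?_⟩
  · induction c using Quotient.inductionOn with | h p => ?_
    induction d using Quotient.inductionOn with | h q => ?_
    rintro ⟨h1, h2⟩
    replace h1 := Quotient.exact ((hfst p).symm.trans (Eq.trans h1 (hfst q)))
    replace h2 := Quotient.exact ((hsnd p).symm.trans (Eq.trans h2 (hsnd q)))
    exact Quotient.sound (act_nonempty_conj.2
      ⟨act_nonempty_conj.2 ⟨h1, h2⟩, (act_nonempty_conj.1 p.2).2⟩)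
  · induction c using Quotient.inductionOn with | h x => ?_
    induction d using Quotient.inductionOn with | h y => ?_
    intro h
    obtain ⟨z, hz⟩ := F.exists_pt x
    obtain ⟨z', hz'⟩ := G.exists_pt y
    have e := Quotient.exact ((G.gamma_mk hz').symm.trans (Eq.trans h.symm (F.gamma_mk hz)))
    have hp : ((pullbackObj F G).eq (x.1, y.1) (x.1, y.1)).act.Nonempty :=
      act_nonempty_conj.2 ⟨act_nonempty_conj.2 ⟨x.2, y.2⟩, act_nonempty_ex.2
        ⟨z.1, act_nonempty_conj.2 ⟨hz, G.nonempty_congr hz' y.2 e⟩⟩⟩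
    exact ⟨Quotient.mk _ ⟨_, hp⟩, hfst ⟨_, hp⟩, hsnd ⟨_, hp⟩⟩

end FunRel

theorem HerbrandTopos.exists_isPullback_isPullback_gamma (f : X ⟶ Z) (g : Y ⟶ Z) :
    ∃ (W : HerbrandTopos P) (p : W ⟶ X) (q : W ⟶ Y), IsPullback p q f g ∧
      IsPullback ((Gamma P).map p) ((Gamma P).map q) ((Gamma P).map f) ((Gamma P).map g) := by
  obtain ⟨F, rfl⟩ := FunRel.exists_hom f
  obtain ⟨G, rfl⟩ := FunRel.exists_hom g
  exact ⟨_, _, _, F.isPullback G, F.isPullback_gamma G⟩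

/-- The object `∇ 1` is terminal, because right adjoints preserve terminal objects. -/
noncomputable def isTerminalNablaPUnit (P : Type u) [PCA P] [Nontrivial P] :
    IsTerminal ((nabla P).obj PUnit) :=
  have := (gammaNablaAdj P).rightAdjoint_preservesLimits
  IsTerminal.isTerminalObj (nabla P) PUnit Types.isTerminalPUnit

instance : HasTerminal (HerbrandTopos P) := (isTerminalNablaPUnit P).hasTerminal

instance : HasPullbacks (HerbrandTopos P) :=
  have : ∀ {X Y Z : HerbrandTopos P} {f : X ⟶ Z} {g : Y ⟶ Z}, HasLimit (cospan f g) :=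
    fun {_ _ _ f g} =>
      have ⟨_, _, _, h, _⟩ := HerbrandTopos.exists_isPullback_isPullback_gamma f g
      h.hasPullback
  hasPullbacks_of_hasLimit_cospan _

instance : HasFiniteLimits (HerbrandTopos P) := hasFiniteLimits_of_hasTerminal_and_pullbacks

instance : PreservesFiniteLimits (Gamma P) := by
  have : PreservesLimit (Functor.empty.{0} (HerbrandTopos P)) (Gamma P) :=
    preservesTerminal_of_iso (Gamma P) ((Gamma P).mapIso
      (terminalIsTerminal.uniqueUpToIso (isTerminalNablaPUnit P)) ≪≫
      (gammaNablaIso P).app PUnit ≪≫ Types.isTerminalPUnit.uniqueUpToIso terminalIsTerminal)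
  have : PreservesLimitsOfShape (Discrete PEmpty.{1}) (Gamma P) :=
    preservesLimitsOfShape_pempty_of_preservesTerminal (Gamma P)
  have h : ∀ {X Y Z : HerbrandTopos P} (f : X ⟶ Z) (g : Y ⟶ Z),
      PreservesLimit (cospan f g) (Gamma P) := fun f g => by
    obtain ⟨_, p, q, h1, h2⟩ := HerbrandTopos.exists_isPullback_isPullback_gamma f g
    exact preservesLimit_of_preserves_limit_cone h1.isLimit
      ((isLimitMapConePullbackConeEquiv (Gamma P) h1.w).symm h2.isLimit)
  have : PreservesLimitsOfShape WalkingCospan (Gamma P) :=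
    ⟨fun {K} => by
      have := h (K.map WalkingCospan.Hom.inl) (K.map WalkingCospan.Hom.inr)
      exact preservesLimit_of_iso_diagram (Gamma P) (diagramIsoCospan K).symm⟩
  exact preservesFiniteLimits_of_preservesTerminal_and_pullbacks (Gamma P)

end

/-! ### Sets as the subtopos of double negation sheaves -/

theorem mainTheorem4 {P : Type u} [PCA P] [Nontrivial P] :
    Limits.HasFiniteLimits (HerbrandTopos P) ∧
    Limits.PreservesFiniteLimits (Gamma P) ∧
    Nonempty (nabla P ⋙ Gamma P ≅ 𝟭 (Type u)) ∧
    (∃ adj : Gamma P ⊣ nabla P,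
      (∀ X : HerbrandTopos P, HerbrandTopos.Represents (unitRel X) (adj.unit.app X)) ∧
      ∀ X : HerbrandTopos P, List.TFAE [
        IsIso (adj.unit.app X),
        ∃ Z : Type u, Nonempty (X ≅ (nabla P).obj Z),
        IsNotNotSheaf X]) ∧
    ∃ h : ∀ Z : Type u, IsNotNotSheaf ((nabla P).obj Z),
      ((IsNotNotSheaf (C := HerbrandTopos P)).lift (nabla P) h).IsEquivalence := by
  have hL := isInitial_of_isEmpty (P := P)
  refine ⟨inferInstance, inferInstance, ⟨gammaNablaIso P⟩,
    ⟨gammaNablaAdj P, gammaNablaAdj_unit, fun X => ?_⟩,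
    fun Z => isNotNotSheaf_of_iso (gammaNablaAdj P) hL (Iso.refl _), ?_⟩
  · tfae_have 1 → 2 := fun _ => ⟨_, ⟨asIso ((gammaNablaAdj P).unit.app X)⟩⟩
    tfae_have 2 → 3 := fun ⟨_, ⟨e⟩⟩ => isNotNotSheaf_of_iso (gammaNablaAdj P) hL e
    tfae_have 3 → 1 := isIso_unit_of_isNotNotSheaf (gammaNablaAdj P) hL
    tfae_finish
  · have : ((IsNotNotSheaf (C := HerbrandTopos P)).lift (nabla P) fun Z =>
        isNotNotSheaf_of_iso (gammaNablaAdj P) hL (Iso.refl _)).EssSurj := ⟨fun S =>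
      have := isIso_unit_of_isNotNotSheaf (gammaNablaAdj P) hL S.2
      ⟨_, ⟨ObjectProperty.isoMk _ (asIso ((gammaNablaAdj P).unit.app S.1)).symm⟩⟩⟩
    exact { }
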